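/- Let $K$ be a field of characteristic $0$. For a finite set of variables $X=\{x_1,\dots,x_d\}$ let $F_d$ be the free metabelian associative unitary $K$-algebra on $X$, i.e. the quotient of the free algebra $K\langle X\rangle$ by the two-sided ideal generated by all $[f,g][h,k]$, $f,g,h,k\in K\langle X\rangle$, and let $F_d'$ be its commutator ideal (the two-sided ideal generated by all $[f,g]$). Let $K[U_d,V_d]$ be the polynomial algebra in the commuting variables $u_1,\dots,u_d,v_1,\dots,v_d$, and let $K[U_d,V_d]_\omega=K[U_d]\otimes_K\omega(K[V_d])$, where $\omega(K[V_d])$ is the augmentation ideal of $K[V_d]$. A nilpotent linear operator $\delta$ of $KX$, $\delta(x_j)=\sum_i\alpha_{ij}x_i$, extends to a derivation $\delta$ of $F_d$, and to the derivation $\delta$ of $K[U_d,V_d]$ with $\delta(u_j)=\sum_i\alpha_{ij}u_i$, $\delta(v_j)=\sum_i\alpha_{ij}v_i$. For a $\delta$-invariant subspace $W$ let $W^\delta=W\cap\ker\delta$, and let $H(W^\delta,z)=\sum_{n\ge0}\dim (W^\delta)^{(n)}z^n$, where $(W^\delta)^{(n)}$ is the homogeneous component of total degree $n$, all $x_j,u_j,v_j$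 having degree $1$. If $X$ is a Jordan basis for $\delta$ with cells of sizes $p_1+1,\dots,p_s+1$ ($p_i\ge0$), the $i$-th cell consisting of the basis vectors $x_{i,0},\dots,x_{i,p_i}$ with $\delta(x_{i,0})=0$ and $\delta(x_{i,k})=x_{i,k-1}$ for $1\le k\le p_i$, we write $\delta=\delta(p_1,\dots,p_s)$ and give the variables $x_{i,k},u_{i,k},v_{i,k}$ the bidegree $(p_i-k,k)$ and total degree $1$. Then $H_{GL_2}(W^\delta,t_1,t_2,z)$ is the formal power series in which the coefficient of $t_1^{n_1}t_2^{n_2}z^n$ is the dimension of the component of $W^\delta$ of bidegree $(n_1,n_2)$ and total degree $n$. Let $d\ge1$. Assume that $\delta(x_d)=0$ and that the span $KX_{d-1}$ of $X_{d-1}=\{x_1,\dots,x_{d-1}\}$ is $\delta$-invariant, $\delta$ acting on it nilpotently (so that the Jordan form of $\delta$ has a $1\times1$ cell); let $\delta$ also denote the corresponding derivations of $F_{d-1}$ and $K[U_{d-1},V_{d-1}]$. Then $$H((F_d')^{\delta},z)=\frac{1}{(1-z)^2}\left(H((F_{d-1}')^{\delta},z)+z\,H(K[U_{d-1},V_{d-1}]_{\omega}^{\delta},z)\right).$$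 If moreover $X_{d-1}$ is a Jordan basis for $\delta$ on $KX_{d-1}$, so that $\delta=\delta(p_1,\dots,p_{s-1})$ on $KX_{d-1}$ and $\delta=\delta(p_1,\dots,p_{s-1},0)$ on $KX_d$, then $$H_{GL_2}((F_d')^{\delta},t_1,t_2,z)=\frac{1}{(1-z)^2}\left(H_{GL_2}((F_{d-1}')^{\delta},t_1,t_2,z)+z\,H_{GL_2}(K[U_{d-1},V_{d-1}]_{\omega}^{\delta},t_1,t_2,z)\right).$$ -/

import Mathlib

noncomputable section

namespace FreeMetabelian

/-- The relations `[f, g] [h, k] = 0` in the free associative unitary algebra `K⟨X⟩`: all values of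
the metabelian identity `[x₁, x₂] [x₃, x₄] = 0`. -/
inductive MetabelianRel (K : Type*) [Field K] (X : Type*) :
    FreeAlgebra K X → FreeAlgebra K X → Prop
  | mk (f g h k : FreeAlgebra K X) :
      MetabelianRel K X ((f * g - g * f) * (h * k - k * h)) 0

/-- The free metabelian associative unitary algebra `F(X)` over `K`, freely generated by `X`. -/
abbrev FreeMet (K : Type*) [Field K] (X : Type*) : Type _ :=
  RingQuot (MetabelianRel K X)

/-- The free generator of the free metabelian algebra indexed by `j`. -/
def gen (K : Type*) [Field K] {X : Type*} (j : X) : FreeMet K X :=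
  RingQuot.mkAlgHom K (MetabelianRel K X) (FreeAlgebra.ι K j)

/-- The free metabelian algebra satisfies the metabelian identity. -/
theorem metabelian_identity {K : Type*} [Field K] {X : Type*} (a b c d : FreeMet K X) :
    (a * b - b * a) * (c * d - d * c) = 0 := by
  obtain ⟨a, rfl⟩ := RingQuot.mkAlgHom_surjective K (MetabelianRel K X) a
  obtain ⟨b, rfl⟩ := RingQuot.mkAlgHom_surjective K (MetabelianRel K X) b
  obtain ⟨c, rfl⟩ := RingQuot.mkAlgHom_surjective K (MetabelianRel K X) c
  obtain ⟨d, rfl⟩ := RingQuot.mkAlgHom_surjective K (MetabelianRel K X) d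
  have h := RingQuot.mkAlgHom_rel K (MetabelianRel.mk (K := K) a b c d)
  simpa using h

/-- The algebra homomorphism `F → F ⊕ ε F` (dual numbers, `ε² = 0`) with `x_j ↦ x_j + ε y_j`. -/
def toDual {K : Type*} [Field K] {X : Type*} (y : X → FreeMet K X) :
    FreeMet K X →ₐ[K] TrivSqZeroExt (FreeMet K X) (FreeMet K X) :=
  RingQuot.liftAlgHom K
    ⟨FreeAlgebra.lift K (fun j => TrivSqZeroExt.inl (gen K j) + TrivSqZeroExt.inr (y j)), by
      intro u v h
      cases h with
      | mk f g h k =>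
        simp only [map_mul, map_sub, map_zero]
        generalize FreeAlgebra.lift K (fun j => TrivSqZeroExt.inl (gen K j) +
          TrivSqZeroExt.inr (y j)) f = f
        generalize FreeAlgebra.lift K (fun j => TrivSqZeroExt.inl (gen K j) +
          TrivSqZeroExt.inr (y j)) g = g
        generalize FreeAlgebra.lift K (fun j => TrivSqZeroExt.inl (gen K j) +
          TrivSqZeroExt.inr (y j)) h = h
        generalize FreeAlgebra.lift K (fun j => TrivSqZeroExt.inl (gen K j) +
          TrivSqZeroExt.inr (y j)) k = k
        ext
        · simpa using metabelian_identity f.fst g.fst h.fst k.fst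
        · have h1 := metabelian_identity f.fst g.fst h.fst k.snd
          have h2 := metabelian_identity f.fst g.fst h.snd k.fst
          have h3 := metabelian_identity f.fst g.snd h.fst k.fst
          have h4 := metabelian_identity f.snd g.fst h.fst k.fst
          simp only [TrivSqZeroExt.snd_mul, TrivSqZeroExt.snd_sub, TrivSqZeroExt.fst_sub,
            TrivSqZeroExt.fst_mul, smul_eq_mul, MulOpposite.smul_eq_mul_unop,
            MulOpposite.unop_op, TrivSqZeroExt.snd_zero]
          have h5 := congrArg₂ (· + ·) (congrArg₂ (· + ·) h1 h2) (congrArg₂ (· + ·) h3 h4)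
          simp only [add_zero] at h5
          rw [← h5]
          simp only [mul_add, add_mul, mul_sub, sub_mul, mul_assoc]
          abel⟩

theorem toDual_gen {K : Type*} [Field K] {X : Type*} (y : X → FreeMet K X) (j : X) :
    toDual y (gen K j) = TrivSqZeroExt.inl (gen K j) + TrivSqZeroExt.inr (y j) := by
  simp [toDual, gen]

theorem fst_toDual {K : Type*} [Field K] {X : Type*} (y : X → FreeMet K X) (f : FreeMet K X) :
    (toDual y f).fst = f := by
  have h : (TrivSqZeroExt.fstHom K (FreeMet K X) (FreeMet K X)).comp (toDual y) =
      AlgHom.id K (FreeMet K X) := by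
    apply RingQuot.ringQuot_ext'
    apply FreeAlgebra.hom_ext
    funext j
    have := toDual_gen y j
    simp only [gen] at this
    simp [this]
  exact DFunLike.congr_fun h f

/-- The derivation of the free metabelian algebra which extends a given map `y` on the free
generators: `der y f` is the coefficient of `ε` in the image of `f` under `x_j ↦ x_j + ε y_j`. -/
def der {K : Type*} [Field K] {X : Type*} (y : X → FreeMet K X) :
    FreeMet K X →ₗ[K] FreeMet K X where
  toFun f := (toDual y f).snd
  map_add' f g := by simp
  map_smul' c f := by simp

/-- `der y` extends `y`. -/
theorem der_gen {K : Type*} [Field K] {X : Type*} (y : X → FreeMet K X) (j : X) :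
    der y (gen K j) = y j := by
  simp [der, toDual_gen]

/-- `der y` is a derivation. -/
theorem der_mul {K : Type*} [Field K] {X : Type*} (y : X → FreeMet K X) (f g : FreeMet K X) :
    der y (f * g) = der y f * g + f * der y g := by
  simp only [der, LinearMap.coe_mk, AddHom.coe_mk, map_mul, TrivSqZeroExt.snd_mul, fst_toDual,
    smul_eq_mul, MulOpposite.smul_eq_mul_unop, MulOpposite.unop_op]
  exact add_comm _ _

/-- The derivation `δ` of `F(X)` with `δ(x_j) = ∑ i, α i j • x_i`. -/
def linDer {K : Type*} [Field K] {X : Type*} [Fintype X] (α : Matrix X X K) :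
    FreeMet K X →ₗ[K] FreeMet K X :=
  der fun j => ∑ i, α i j • gen K i

/-- The derivation `δ` of `K[U, V]` with `δ(u_j) = ∑ i, α i j • u_i`, `δ(v_j) = ∑ i, α i j • v_i`.
The variable `u_j` is `X (Sum.inl j)` and `v_j` is `X (Sum.inr j)`. -/
def polyDer {K : Type*} [Field K] {X : Type*} [Fintype X] (α : Matrix X X K) :
    Derivation K (MvPolynomial (X ⊕ X) K) (MvPolynomial (X ⊕ X) K) :=
  MvPolynomial.mkDerivation K
    (Sum.elim (fun j => ∑ i, α i j • MvPolynomial.X (Sum.inl i))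
      (fun j => ∑ i, α i j • MvPolynomial.X (Sum.inr i)))

/-- The commutator ideal `F'`: the two-sided ideal of `F(X)` generated by all `f g - g f`. -/
def commutatorIdeal (K : Type*) [Field K] (X : Type*) : TwoSidedIdeal (FreeMet K X) :=
  TwoSidedIdeal.span {c | ∃ f g : FreeMet K X, c = f * g - g * f}

/-- The space `(F')^δ` of `δ`-constants in the commutator ideal, `δ` the derivation given by `α`. -/
def commConstants {K : Type*} [Field K] {X : Type*} [Fintype X] (α : Matrix X X K) :
    Submodule K (FreeMet K X) :=
  (TwoSidedIdeal.asIdeal (commutatorIdeal K X)).restrictScalars K ⊓ LinearMap.ker (linDer α)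

/-- `K[U, V]_ω = K[U] ⊗ ω(K[V])`, as a subspace of `K[U, V] = K[U] ⊗ K[V]`, where `ω(K[V])` is the
augmentation ideal of `K[V]` (the polynomials without constant term). -/
def omegaIdeal (K : Type*) [Field K] (X : Type*) : Submodule K (MvPolynomial (X ⊕ X) K) :=
  Submodule.span K {h | ∃ f g : MvPolynomial X K, MvPolynomial.constantCoeff g = 0 ∧
    h = MvPolynomial.rename Sum.inl f * MvPolynomial.rename Sum.inr g}

/-- The space `K[U, V]_ω^δ` of `δ`-constants in `K[U, V]_ω`. -/
def omegaConstants {K : Type*} [Field K] {X : Type*} [Fintype X] (α : Matrix X X K) :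
    Submodule K (MvPolynomial (X ⊕ X) K) :=
  omegaIdeal K X ⊓ LinearMap.ker (polyDer α).toLinearMap

/-- The homogeneous component of multidegree `m` of `F(X)`, where the generator `x_j` has
multidegree `w j`: the span of all words in the generators of total multidegree `m`. -/
def component (K : Type*) [Field K] {X τ : Type*} (w : X → (τ →₀ ℕ)) (m : τ →₀ ℕ) :
    Submodule K (FreeMet K X) :=
  Submodule.span K {f | ∃ l : List X, (l.map w).sum = m ∧ f = (l.map (gen K)).prod}

/-- The homogeneous component of multidegree `m` of `K[U, V]`, where both `u_j` and `v_j` have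
multidegree `w j`. -/
def polyComponent (K : Type*) [Field K] {X τ : Type*} (w : X → (τ →₀ ℕ)) (m : τ →₀ ℕ) :
    Submodule K (MvPolynomial (X ⊕ X) K) :=
  MvPolynomial.weightedHomogeneousSubmodule K (Sum.elim w w) m

/-- The Hilbert series `∑ m, dim (W ∩ A_m) z^m` of a homogeneous subspace `W` of a space `A` with
homogeneous components `A_m`, a formal power series in variables indexed by `τ`. -/
def hilbertSeries {K : Type*} [Field K] {A τ : Type*} [AddCommGroup A] [Module K A]
    (comp : (τ →₀ ℕ) → Submodule K A) (W : Submodule K A) : MvPowerSeries τ ℚ :=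
  fun m => (Module.finrank K ↥(W ⊓ comp m) : ℚ)

/-- The multidegree which gives every variable total degree `1`; the series is in one variable `z`.
Note that `PowerSeries ℚ` is `MvPowerSeries Unit ℚ`. -/
def totalDegree (X : Type*) : X → (Unit →₀ ℕ) :=
  fun _ => Finsupp.single () 1

/-- The Hilbert series `H((F')^δ, z)` with respect to the total degree. -/
def hilbertComm {K : Type*} [Field K] {X : Type*} [Fintype X] (α : Matrix X X K) :
    PowerSeries ℚ :=
  hilbertSeries (component K (totalDegree X)) (commConstants α)

/-- The Hilbert series `H(K[U, V]_ω^δ, z)` with respect to the total degree. -/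
def hilbertOmega {K : Type*} [Field K] {X : Type*} [Fintype X] (α : Matrix X X K) :
    PowerSeries ℚ :=
  hilbertSeries (polyComponent K (totalDegree X)) (omegaConstants α)

/-- Indices of a Jordan basis with cells of sizes `p i + 1`: the pair `⟨i, k⟩`, `0 ≤ k ≤ p i`, is
the `k`-th basis vector (counted from `0`) of the `i`-th cell. -/
abbrev JordanIndex {s : ℕ} (p : Fin s → ℕ) : Type := (i : Fin s) × Fin (p i + 1)

/-- The matrix of `δ(p₁, …, p_s)` in its Jordan basis: `x_{i,k} ↦ x_{i,k-1}` for `k ≥ 1`, and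
`x_{i,0} ↦ 0`. -/
def jordanMatrix (K : Type*) [Field K] {s : ℕ} (p : Fin s → ℕ) :
    Matrix (JordanIndex p) (JordanIndex p) K :=
  fun a b => if a.1 = b.1 ∧ (a.2 : ℕ) + 1 = (b.2 : ℕ) then 1 else 0

/-- The multidegree for the variables `t₁, t₂, z` (in this order): `x_{i,k}` has bidegree
`(p i - k, k)` and total degree `1`. -/
def jordanDegree {s : ℕ} (p : Fin s → ℕ) (a : JordanIndex p) : Fin 3 →₀ ℕ :=
  Finsupp.single 0 (p a.1 - (a.2 : ℕ)) + Finsupp.single 1 (a.2 : ℕ) + Finsupp.single 2 1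

/-- The bigraded Hilbert series `H_{GL₂}((F')^δ, t₁, t₂, z)` for `δ = δ(p₁, …, p_s)`. -/
def hilbertCommGL (K : Type*) [Field K] {s : ℕ} (p : Fin s → ℕ) : MvPowerSeries (Fin 3) ℚ :=
  hilbertSeries (component K (jordanDegree p)) (commConstants (jordanMatrix K p))

/-- The bigraded Hilbert series `H_{GL₂}(K[U, V]_ω^δ, t₁, t₂, z)` for `δ = δ(p₁, …, p_s)`. -/
def hilbertOmegaGL (K : Type*) [Field K] {s : ℕ} (p : Fin s → ℕ) : MvPowerSeries (Fin 3) ℚ :=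
  hilbertSeries (polyComponent K (jordanDegree p)) (omegaConstants (jordanMatrix K p))

end FreeMetabelian

end

/-! The commutator ideal `F'` squares to zero. Hence left multiplication by x_j (as u_j) and
commutation with x_j (as v_j) make it a module over K[U, V], generated by the [x_i, x_j]. The Fox
derivatives attached to x_j ↦ u_j and x_j ↦ u_j - v_j map `F'` to K[U, V] ⊗ KX, and the fundamental
formula `foxSum_fox` puts the image in the kernel Z of x_j ↦ v_j.

This map `F'` → Z is bijective: it is the exactness of the Koszul complex of the v_j, with [x_i,
x_j] in the role of x_i ∧ x_j and the Jacobi identity giving the Koszul relations. Characteristic 0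
enters here. Differentiation in V is a contracting homotopy up to E + 1 or E + 2, where E is the
Euler derivation in V, and these operators are invertible (`fox_magnusInv`, `magnusInv_fox_smul`).
The map respects δ and the multidegree, so constants of `F'` can be counted in Z
(`finrank_commSub_eq`).

Let x_o be the constant generator that splits off and Y the remaining ones. Multiplication by u_o or
v_o commutes with δ and is injective. The quotient of the constants in Z by u_o times themselves is
the space of constants not involving u_o (`finrank_foxConstants_eq_add`). The quotient of these by
their v_o-multiples consists of the constants of Z for Y together with those of K[U_Y, V_Y]_ω, the
latter being the coordinate at x_o, which shifts degrees by that of x_o (`finrank_varFree_eq_add`).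
Each quotient contributes a factor 1 - z.

The delicate point is surjectivity in the second quotient, since passing to constants is not right
exact in general. A constant g of the ω part is E b for a constant b, and z_o = g, z_y = -v_o
∂b/∂v_y is then a constant of Z lifting g (`exists_resY_eq`). -/

noncomputable section

/-! ### Polynomials in U and V: the Euler derivation, the ideal K[U, V]_ω and their compatibility
with δ. -/

namespace FreeMetabelian

open MvPolynomial

/-- The Euler derivation of `K[U, V]` with respect to the variables `V`. -/
def eulerV (K : Type*) [Field K] (X : Type*) :
    Derivation K (MvPolynomial (X ⊕ X) K) (MvPolynomial (X ⊕ X) K) :=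
  mkDerivation K (Sum.elim 0 (fun j => MvPolynomial.X (Sum.inr j)))

/-- The degree of a monomial of `K[U, V]` in the variables `V`. -/
def vdeg {X : Type*} : (X ⊕ X →₀ ℕ) →+ ℕ :=
  Finsupp.weight (Sum.elim (fun _ => 0) (fun _ => 1))

/-- The substitution `v_j ↦ 0` in `K[U, V]`. -/
def killV (K : Type*) [Field K] (X : Type*) :
    MvPolynomial (X ⊕ X) K →ₐ[K] MvPolynomial (X ⊕ X) K :=
  aeval (Sum.elim (fun j => MvPolynomial.X (Sum.inl j)) 0)

section Poly

variable {K : Type*} [Field K] {X : Type*}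

theorem algHom_derivation_comm {σ τ : Type*} (φ : MvPolynomial σ K →ₐ[K] MvPolynomial τ K)
    (d : Derivation K (MvPolynomial σ K) (MvPolynomial σ K))
    (d' : Derivation K (MvPolynomial τ K) (MvPolynomial τ K))
    (h : ∀ i, φ (d (MvPolynomial.X i)) = d' (φ (MvPolynomial.X i))) (f : MvPolynomial σ K) :
    φ (d f) = d' (φ f) := by
  induction f using MvPolynomial.induction_on with
  | C a => simp [derivation_C, ← algebraMap_eq]
  | add p q hp hq => simp [hp, hq]
  | mul_X p i hp => simp [Derivation.leibniz, hp, h]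

theorem vdeg_single_inl (i : X) (n : ℕ) : vdeg (Finsupp.single (Sum.inl i : X ⊕ X) n) = 0 := by
  simp [vdeg, Finsupp.weight_single]

theorem vdeg_single_inr (i : X) (n : ℕ) : vdeg (Finsupp.single (Sum.inr i : X ⊕ X) n) = n := by
  simp [vdeg, Finsupp.weight_single]

theorem eulerV_X_inl (i : X) : eulerV K X (MvPolynomial.X (Sum.inl i)) = 0 := by
  simp [eulerV, mkDerivation_X]

theorem eulerV_X_inr (i : X) :
    eulerV K X (MvPolynomial.X (Sum.inr i)) = MvPolynomial.X (Sum.inr i) := by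
  simp [eulerV, mkDerivation_X]

theorem eulerV_monomial (s : X ⊕ X →₀ ℕ) (c : K) :
    eulerV K X (monomial s c) = (vdeg s : K) • monomial s c := by
  induction s using Finsupp.induction_linear generalizing c with
  | zero => simp [derivation_C, ← MvPolynomial.C_apply]
  | add s t hs ht =>
    have : monomial (s + t) c = monomial s c * monomial t (1 : K) := by simp [monomial_mul]
    rw [this, Derivation.leibniz, hs, ht, map_add]
    push_cast
    simp only [smul_eq_mul, mul_smul_comm, add_smul, mul_comm (monomial t (1 : K)), smul_mul_assoc]
    abel
  | single i n =>
    have : monomial (Finsupp.single i n) c = C c * (MvPolynomial.X i) ^ n := by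
      rw [C_mul_X_pow_eq_monomial]
    rw [this, C_mul', Derivation.map_smul, Derivation.leibniz_pow]
    cases i with
    | inl i => simp [eulerV_X_inl, vdeg_single_inl]
    | inr i =>
      rw [eulerV_X_inr, vdeg_single_inr]
      rcases n with _ | n
      · simp
      · simp only [Nat.add_sub_cancel, smul_eq_mul, ← pow_succ, ← Nat.cast_smul_eq_nsmul K]
        rw [smul_comm]

theorem coeff_eulerV (s : X ⊕ X →₀ ℕ) (f : MvPolynomial (X ⊕ X) K) :
    coeff s (eulerV K X f) = vdeg s * coeff s f := by
  classical
  induction f using MvPolynomial.induction_on' with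
  | add p q hp hq => simp [hp, hq, mul_add]
  | monomial t c =>
    rw [eulerV_monomial, coeff_smul, coeff_monomial, smul_eq_mul]
    split_ifs with h <;> simp [h]

theorem killV_monomial (s : X ⊕ X →₀ ℕ) (c : K) :
    killV K X (monomial s c) = if vdeg s = 0 then monomial s c else 0 := by
  induction s using Finsupp.induction_linear generalizing c with
  | zero => simp [killV, ← MvPolynomial.C_apply, algebraMap_eq]
  | add s t hs ht =>
    have : monomial (s + t) c = monomial s c * monomial t (1 : K) := by simp [monomial_mul]
    rw [this, map_mul, hs, ht, map_add]
    by_cases h1 : vdeg s = 0 <;> by_cases h2 : vdeg t = 0 <;> simp [h1, h2]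
  | single i n =>
    rw [← C_mul_X_pow_eq_monomial, map_mul, map_pow]
    cases i with
    | inl i => simp [killV, vdeg_single_inl, algebraMap_eq]
    | inr i => rcases n with _ | n <;> simp [killV, vdeg_single_inr, algebraMap_eq]

theorem coeff_killV (s : X ⊕ X →₀ ℕ) (f : MvPolynomial (X ⊕ X) K) :
    coeff s (killV K X f) = if vdeg s = 0 then coeff s f else 0 := by
  classical
  induction f using MvPolynomial.induction_on' with
  | add p q hp hq => simp only [map_add, coeff_add, hp, hq]; split_ifs <;> simp
  | monomial t c =>
    rw [killV_monomial, coeff_monomial]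
    by_cases h : t = s
    · subst h; split_ifs <;> simp_all
    · split_ifs <;> simp [coeff_monomial, h]

theorem killV_eq_zero_iff (f : MvPolynomial (X ⊕ X) K) :
    killV K X f = 0 ↔ ∀ s, coeff s f ≠ 0 → vdeg s ≠ 0 := by
  rw [MvPolynomial.ext_iff]
  simp only [coeff_killV, coeff_zero]
  refine forall_congr' fun s => ?_
  split_ifs with h <;> simp [h]

theorem mul_mem_omegaIdeal (p f : MvPolynomial (X ⊕ X) K) (hf : f ∈ omegaIdeal K X) :
    p * f ∈ omegaIdeal K X := by
  have hX : ∀ i, ∀ f ∈ omegaIdeal K X, MvPolynomial.X i * f ∈ omegaIdeal K X := by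
    intro i f hf
    induction hf using Submodule.span_induction with
    | zero => simp
    | add x y _ _ hx hy => rw [mul_add]; exact add_mem hx hy
    | smul a x _ hx => rw [mul_smul_comm]; exact Submodule.smul_mem _ _ hx
    | mem x hx =>
      obtain ⟨f, g, hg, rfl⟩ := hx
      apply Submodule.subset_span
      cases i with
      | inl i =>
        exact ⟨MvPolynomial.X i * f, g, hg, by simp [mul_assoc]⟩
      | inr i =>
        exact ⟨f, MvPolynomial.X i * g, by simp, by simp [mul_left_comm]⟩
  induction p using MvPolynomial.induction_on generalizing f with
  | C a => rw [C_mul']; exact Submodule.smul_mem _ _ hf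
  | add p q hp hq => rw [add_mul]; exact add_mem (hp _ hf) (hq _ hf)
  | mul_X p i hp => rw [mul_assoc]; exact hp _ (hX i _ hf)

theorem X_inr_mem_omegaIdeal (j : X) : MvPolynomial.X (Sum.inr j) ∈ omegaIdeal K X :=
  Submodule.subset_span ⟨1, MvPolynomial.X j, by simp, by simp⟩

/-- K[U, V]_ω is the ideal generated by the v_j, hence a monomial ideal; membership can be tested
monomial by monomial, by positivity of the V-degree. -/
theorem mem_omegaIdeal_iff (f : MvPolynomial (X ⊕ X) K) :
    f ∈ omegaIdeal K X ↔ killV K X f = 0 := by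
  constructor
  · intro hf
    induction hf using Submodule.span_induction with
    | zero => simp
    | add x y _ _ hx hy => simp [hx, hy]
    | smul a x _ hx => simp [hx]
    | mem x hx =>
      obtain ⟨f, g, hg, rfl⟩ := hx
      have : killV K X (rename Sum.inr g) = C (constantCoeff g) := by
        simp only [killV, aeval_rename, Sum.elim_comp_inr]
        rw [aeval_zero]; simp [algebraMap_eq]
      rw [map_mul, this, hg]; simp
  · intro h
    rw [killV_eq_zero_iff] at h
    rw [f.as_sum]
    refine Submodule.sum_mem _ fun s hs => ?_
    have hs' := h s (mem_support_iff.1 hs)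
    have : ∃ j, s (Sum.inr j) ≠ 0 := by
      by_contra! hc
      apply hs'
      simp only [vdeg, Finsupp.weight_apply, Finsupp.sum]
      refine Finset.sum_eq_zero fun i _ => ?_
      cases i <;> simp [hc]
    obtain ⟨j, hj⟩ := this
    have he : monomial s (coeff s f) =
        monomial (s - Finsupp.single (Sum.inr j) 1) (coeff s f) * MvPolynomial.X (Sum.inr j) := by
      rw [MvPolynomial.X, monomial_mul, mul_one, tsub_add_cancel_of_le]
      simpa [Finsupp.single_le_iff] using Nat.one_le_iff_ne_zero.2 hj
    rw [he]
    exact mul_mem_omegaIdeal _ _ (X_inr_mem_omegaIdeal j)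

/-- E + k is diagonal on monomials with eigenvalues `vdeg s + k`. The hypothesis only bites for k =
0, where it says that f has no V-free monomials. -/
theorem eulerV_add_smul_injective [CharZero K] (k : ℕ) (f : MvPolynomial (X ⊕ X) K)
    (hk : ∀ s, coeff s f ≠ 0 → vdeg s + k ≠ 0) (h : eulerV K X f + (k : K) • f = 0) : f = 0 := by
  ext s
  by_contra hs
  have h1 := congrArg (coeff s) h
  rw [coeff_add, coeff_smul, coeff_eulerV, smul_eq_mul, ← add_mul, coeff_zero] at h1
  have h2 : ((vdeg s : K) + k) ≠ 0 := by exact_mod_cast hk s hs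
  exact (mul_ne_zero h2 hs) h1

/-- Each coefficient is divided by its eigenvalue. The control of the support ensures that the
solution keeps the multidegree of g and stays in K[U, V]_ω if g is there. -/
theorem exists_eulerV_add_smul_eq [CharZero K] (k : ℕ) (g : MvPolynomial (X ⊕ X) K)
    (hk : ∀ s, coeff s g ≠ 0 → vdeg s + k ≠ 0) :
    ∃ f, eulerV K X f + (k : K) • f = g ∧ ∀ s, coeff s f ≠ 0 → coeff s g ≠ 0 := by
  classical
  have hc : ∀ s, coeff s (∑ t ∈ g.support, monomial t (((vdeg t : K) + k)⁻¹ * coeff t g)) =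
      ((vdeg s : K) + k)⁻¹ * coeff s g := by
    intro s
    simp only [coeff_sum, coeff_monomial, Finset.sum_ite_eq']
    split_ifs with h
    · rfl
    · rw [notMem_support_iff.1 h, mul_zero]
  refine ⟨∑ t ∈ g.support, monomial t (((vdeg t : K) + k)⁻¹ * coeff t g), ?_, fun s hs => ?_⟩
  rotate_left
  · rw [hc] at hs; exact right_ne_zero_of_mul hs
  · ext s
    rw [coeff_add, coeff_smul, coeff_eulerV, hc, smul_eq_mul, ← add_mul]
    by_cases hs : coeff s g = 0
    · simp [hs]
    · have h2 : ((vdeg s : K) + k) ≠ 0 := by exact_mod_cast hk s hs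
      rw [mul_inv_cancel_left₀ h2]

theorem derivation_sum_apply {ι A : Type*} [CommRing A] [Algebra K A] (s : Finset ι)
    (D : ι → Derivation K A A) (f : A) : (∑ i ∈ s, D i) f = ∑ i ∈ s, D i f := by
  classical
  induction s using Finset.induction_on with
  | empty => simp
  | insert a s ha ih => simp [Finset.sum_insert ha, ih]

theorem eulerV_eq_sum [Fintype X] (f : MvPolynomial (X ⊕ X) K) :
    eulerV K X f = ∑ j, MvPolynomial.X (Sum.inr j) * pderiv (Sum.inr j) f := by
  classical
  have : eulerV K X = ∑ j, (MvPolynomial.X (Sum.inr j) : MvPolynomial (X ⊕ X) K) •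
      pderiv (R := K) (Sum.inr j) := by
    apply derivation_ext
    intro i
    rw [derivation_sum_apply]
    cases i with
    | inl i => simp [eulerV_X_inl, pderiv_X]
    | inr i => simp [eulerV_X_inr, pderiv_X, Pi.single_apply]
  rw [this]
  simp [derivation_sum_apply]

section Fin

variable [Fintype X] (α : Matrix X X K)

theorem polyDer_X_inl (j : X) : polyDer α (MvPolynomial.X (Sum.inl j)) =
    ∑ i, α i j • MvPolynomial.X (Sum.inl i) := by
  simp [polyDer, mkDerivation_X]

theorem polyDer_X_inr (j : X) : polyDer α (MvPolynomial.X (Sum.inr j)) =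
    ∑ i, α i j • MvPolynomial.X (Sum.inr i) := by
  simp [polyDer, mkDerivation_X]

theorem killV_polyDer (f : MvPolynomial (X ⊕ X) K) :
    killV K X (polyDer α f) = polyDer α (killV K X f) := by
  apply algHom_derivation_comm
  intro i
  cases i with
  | inl i => simp [polyDer_X_inl, killV]
  | inr i => simp [polyDer_X_inr, killV]

theorem eulerV_polyDer (f : MvPolynomial (X ⊕ X) K) :
    eulerV K X (polyDer α f) = polyDer α (eulerV K X f) := by
  have : (⁅eulerV K X, polyDer α⁆ : Derivation K (MvPolynomial (X ⊕ X) K) _) = 0 := by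
    apply derivation_ext
    intro i
    cases i with
    | inl i => simp [Derivation.commutator_apply, polyDer_X_inl, eulerV_X_inl]
    | inr i => simp [Derivation.commutator_apply, polyDer_X_inr, eulerV_X_inr]
  have h := DFunLike.congr_fun this f
  rwa [Derivation.commutator_apply, Derivation.zero_apply, sub_eq_zero] at h

/-- The commutator of two derivations is a derivation, so it suffices to compare on variables. The
partial derivatives in V transform under δ by the dual action, which is what makes the lift in
`exists_resY_eq` a constant. -/
theorem pderiv_polyDer (i : X) (f : MvPolynomial (X ⊕ X) K) :
    pderiv (Sum.inr i) (polyDer α f) =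
      polyDer α (pderiv (Sum.inr i) f) + ∑ j, α i j • pderiv (Sum.inr j) f := by
  classical
  have : ⁅pderiv (R := K) (Sum.inr i : X ⊕ X), polyDer α⁆ =
      ∑ j, α i j • pderiv (R := K) (Sum.inr j : X ⊕ X) := by
    apply derivation_ext
    intro k
    rw [derivation_sum_apply]
    cases k with
    | inl k => simp [Derivation.commutator_apply, polyDer_X_inl, pderiv_X]
    | inr k =>
      simp [Derivation.commutator_apply, polyDer_X_inr, pderiv_X, Pi.single_apply,
        apply_ite (polyDer α)]
  have h := DFunLike.congr_fun this f
  rw [Derivation.commutator_apply, derivation_sum_apply, sub_eq_iff_eq_add] at h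
  rw [h, add_comm]; rfl

end Fin

end Poly

end FreeMetabelian

end
-- The commutator ideal as a K[U, V]-module.
noncomputable section

namespace FreeMetabelian

open MvPolynomial

/-- The subalgebra generated by the `a i` is commutative, so polynomials can be evaluated there. The
target of interest is a noncommutative endomorphism ring. -/
theorem exists_algHom_of_commute {K σ A : Type*} [Field K] [Ring A] [Algebra K A] (a : σ → A)
    (h : ∀ i j, a i * a j = a j * a i) :
    ∃ φ : MvPolynomial σ K →ₐ[K] A, ∀ i, φ (MvPolynomial.X i) = a i := by
  have hc : ∀ x ∈ Set.range a, ∀ y ∈ Set.range a, x * y = y * x := by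
    rintro _ ⟨i, rfl⟩ _ ⟨j, rfl⟩
    exact h i j
  have hm := Algebra.isMulCommutative_adjoin K hc
  let _ : CommRing (Algebra.adjoin K (Set.range a)) :=
    { (inferInstance : Ring (Algebra.adjoin K (Set.range a))) with
      mul_comm := fun a b => hm.is_comm.comm a b }
  let b : σ → Algebra.adjoin K (Set.range a) := fun i => ⟨a i, Algebra.subset_adjoin ⟨i, rfl⟩⟩
  refine ⟨(Algebra.adjoin K (Set.range a)).val.comp (aeval b), fun i => ?_⟩
  simp [b]

/-- The commutator ideal of a ring. -/
def ringCommutatorIdeal (A : Type*) [Ring A] : TwoSidedIdeal A :=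
  TwoSidedIdeal.span {c | ∃ f g : A, c = f * g - g * f}

/-- The commutator ideal as a subspace. -/
def commSub (K A : Type*) [Field K] [Ring A] [Algebra K A] : Submodule K A :=
  (TwoSidedIdeal.asIdeal (ringCommutatorIdeal A)).restrictScalars K

/-- Rings with the metabelian identity. -/
class IsMetabelianRing (A : Type*) [Ring A] : Prop where
  metabelian : ∀ a b c d : A, (a * b - b * a) * (c * d - d * c) = 0

/-- An algebra `A` generated by `x_j`, `j ∈ X`, with the homomorphisms `left : x_j ↦ u_j`,
`right : x_j ↦ u_j - v_j` to `K[U, V]` and the partial Fox derivatives with respect to them. -/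
class MagnusModel (K X A : Type*) [Field K] [DecidableEq X] [Ring A] [Algebra K A] where
  x : X → A
  adjoin_x : Algebra.adjoin K (Set.range x) = ⊤
  left : A →ₐ[K] MvPolynomial (X ⊕ X) K
  right : A →ₐ[K] MvPolynomial (X ⊕ X) K
  fox : A →ₗ[K] X → MvPolynomial (X ⊕ X) K
  left_x : ∀ j, left (x j) = MvPolynomial.X (Sum.inl j)
  right_x : ∀ j, right (x j) = MvPolynomial.X (Sum.inl j) - MvPolynomial.X (Sum.inr j)
  fox_x : ∀ j, fox (x j) = Pi.single j 1
  fox_mul : ∀ f g j, fox (f * g) j = left f * fox g j + fox f j * right g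

open MagnusModel IsMetabelianRing

section

variable {K A : Type*} [Field K] [Ring A] [Algebra K A]

theorem mem_commSub {c : A} : c ∈ commSub K A ↔ c ∈ ringCommutatorIdeal A := Iff.rfl

theorem commutator_mem (f g : A) : f * g - g * f ∈ commSub K A :=
  TwoSidedIdeal.subset_span ⟨f, g, rfl⟩

theorem algHom_commSub {B : Type*} [CommRing B] [Algebra K B] (φ : A →ₐ[K] B) {c : A}
    (hc : c ∈ commSub K A) : φ c = 0 := by
  rw [mem_commSub] at hc
  induction hc using TwoSidedIdeal.span_induction with
  | mem x hx => obtain ⟨f, g, rfl⟩ := hx; simp [mul_comm]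
  | zero => simp
  | add x y _ _ hx hy => simp [hx, hy]
  | neg x _ hx => simp [hx]
  | left_absorb a x _ hx => simp [hx]
  | right_absorb b x _ hx => simp [hx]

theorem mul_mem_commSub (a : A) {c : A} (hc : c ∈ commSub K A) :
    a * c ∈ commSub K A :=
  TwoSidedIdeal.mul_mem_left (ringCommutatorIdeal A) _ _ hc

theorem commSub_mul_mem (a : A) {c : A} (hc : c ∈ commSub K A) :
    c * a ∈ commSub K A :=
  TwoSidedIdeal.mul_mem_right (ringCommutatorIdeal A) _ _ hc

/-- The identity a[h, k] = [ah, k] - [a, k]h absorbs the middle factor into commutators. -/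
theorem commutator_mul_mul_commutator [IsMetabelianRing A] (f g a h k : A) :
    (f * g - g * f) * a * (h * k - k * h) = 0 := by
  have h1 := metabelian f g (a * h) k
  have h2 := metabelian f g a k
  calc (f * g - g * f) * a * (h * k - k * h)
      = (f * g - g * f) * (a * h * k - k * (a * h)) -
          (f * g - g * f) * (a * k - k * a) * h := by noncomm_ring
    _ = 0 := by rw [h1, h2]; simp

theorem commSub_mul_commSub [IsMetabelianRing A] {c d : A} (hc : c ∈ commSub K A) (hd : d ∈ commSub K A) :
    c * d = 0 := by
  -- The arbitrary middle factor lets the induction pass through multiplication of c from the right.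
  have h1 : ∀ a f g : A, c * a * (f * g - g * f) = 0 := by
    rw [mem_commSub] at hc
    induction hc using TwoSidedIdeal.span_induction with
    | mem x hx =>
      obtain ⟨f, g, rfl⟩ := hx
      exact fun a h k => commutator_mul_mul_commutator f g a h k
    | zero => simp
    | add x y _ _ hx hy => intro a f g; rw [add_mul, add_mul, hx, hy, add_zero]
    | neg x _ hx => intro a f g; rw [neg_mul, neg_mul, hx, neg_zero]
    | left_absorb b x _ hx => intro a f g; rw [mul_assoc b, mul_assoc b, hx, mul_zero]
    | right_absorb b x _ hx => intro a f g; rw [mul_assoc x, hx]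
  have h2 : ∀ a : A, c * a * d = 0 := by
    rw [mem_commSub] at hd
    induction hd using TwoSidedIdeal.span_induction with
    | mem x hx => obtain ⟨f, g, rfl⟩ := hx; exact fun a => h1 a f g
    | zero => simp
    | add x y _ _ hx hy => intro a; rw [mul_add, hx, hy, add_zero]
    | neg x _ hx => intro a; rw [mul_neg, hx, neg_zero]
    | left_absorb b x _ hx => intro a; rw [← mul_assoc, mul_assoc c, hx]
    | right_absorb b x _ hx => intro a; rw [← mul_assoc, hx, zero_mul]
  simpa using h2 1

/-- Left multiplication on the commutator ideal. -/
def leftEnd (a : A) : Module.End K (commSub K A) :=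
  (LinearMap.mulLeft K a).restrict fun _ hc => mul_mem_commSub a hc

/-- Right multiplication on the commutator ideal. -/
def rightEnd (a : A) : Module.End K (commSub K A) :=
  (LinearMap.mulRight K a).restrict fun _ hc => commSub_mul_mem a hc

@[simp] theorem coe_leftEnd (a : A) (c : commSub K A) :
    (leftEnd a c : A) = a * c := rfl

@[simp] theorem coe_rightEnd (a : A) (c : commSub K A) :
    (rightEnd a c : A) = c * a := rfl

theorem leftEnd_mul_rightEnd (a b : A) :
    leftEnd (K := K) a * rightEnd b = rightEnd b * leftEnd a := by
  ext c
  simp [mul_assoc]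

/-- The difference of the two sides is multiplication by [a, b], which kills the commutator ideal
because that ideal squares to zero. -/
theorem leftEnd_mul_comm [IsMetabelianRing A] (a b : A) :
    leftEnd (K := K) a * leftEnd b = leftEnd b * leftEnd a := by
  ext c
  have := commSub_mul_commSub (K := K) (commutator_mem a b) c.2
  rw [sub_mul, sub_eq_zero] at this
  simpa [mul_assoc] using this

theorem rightEnd_mul_comm [IsMetabelianRing A] (a b : A) :
    rightEnd (K := K) a * rightEnd b = rightEnd b * rightEnd a := by
  ext c
  have := commSub_mul_commSub (K := K) c.2 (commutator_mem b a)
  rw [mul_sub, sub_eq_zero] at this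
  simpa [mul_assoc] using this

variable {X : Type*} [DecidableEq X] [MagnusModel K X A]

variable (K X) in
theorem mem_adjoin_x (a : A) : a ∈ Algebra.adjoin K (Set.range (x K : X → A)) := by
  rw [adjoin_x]; trivial

variable (K A) in
/-- The commutator `[x_i, x_j]`. -/
def genComm (i j : X) : commSub K A := ⟨_, commutator_mem (x K i : A) (x K j : A)⟩

theorem genComm_swap (i j : X) : genComm K A j i = - genComm K A i j := by
  ext; simp [genComm]

variable [IsMetabelianRing A]

variable (K X A) in
/-- The operators by which `u_j` and `v_j` act on the commutator ideal. -/
def genEnd : X ⊕ X → Module.End K (commSub K A) :=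
  Sum.elim (fun j => leftEnd (x K j : A)) (fun j => leftEnd (x K j : A) - rightEnd (x K j : A))

theorem genEnd_comm (i j : X ⊕ X) :
    genEnd K A X i * genEnd K A X j = genEnd K A X j * genEnd K A X i := by
  have l : ∀ (a b : A) (c : commSub K A), leftEnd a (leftEnd b c) = leftEnd b (leftEnd a c) :=
    fun a b c => DFunLike.congr_fun (leftEnd_mul_comm a b) c
  have r : ∀ (a b : A) (c : commSub K A), rightEnd a (rightEnd b c) = rightEnd b (rightEnd a c) :=
    fun a b c => DFunLike.congr_fun (rightEnd_mul_comm a b) c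
  have m : ∀ (a b : A) (c : commSub K A), leftEnd a (rightEnd b c) = rightEnd b (leftEnd a c) :=
    fun a b c => DFunLike.congr_fun (leftEnd_mul_rightEnd a b) c
  refine LinearMap.ext fun c => ?_
  rw [Module.End.mul_apply, Module.End.mul_apply]
  rcases i with i | i <;> rcases j with j | j <;>
    simp only [genEnd, Sum.elim_inl, Sum.elim_inr, LinearMap.sub_apply, map_sub, m,
      l (x K i) (x K j), r (x K i) (x K j)]
  abel

variable (K X A) in
/-- The action of `K[U, V]` on the commutator ideal: `u_j` acts by left multiplication by `x_j` and
`v_j` acts by commutation with `x_j`. -/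
def actComm : MvPolynomial (X ⊕ X) K →ₐ[K] Module.End K (commSub K A) :=
  (exists_algHom_of_commute (genEnd K A X) genEnd_comm).choose

theorem actComm_X (i : X ⊕ X) : actComm K A X (MvPolynomial.X i) = genEnd K A X i :=
  (exists_algHom_of_commute (genEnd K A X) genEnd_comm).choose_spec i

instance : Module (MvPolynomial (X ⊕ X) K) (commSub K A) :=
  Module.compHom _ (actComm K A X).toRingHom

theorem polySmul_def (h : MvPolynomial (X ⊕ X) K) (c : commSub K A) :
    h • c = actComm K A X h c := rfl

instance : IsScalarTower K (MvPolynomial (X ⊕ X) K) (commSub K A) where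
  smul_assoc k h c := by simp [polySmul_def]

theorem coe_X_inl_smul (i : X) (c : commSub K A) :
    (((MvPolynomial.X (Sum.inl i) : MvPolynomial (X ⊕ X) K) • c : commSub K A) : A) =
      x K i * c := by
  rw [polySmul_def, actComm_X]; rfl

theorem coe_X_inr_smul (i : X) (c : commSub K A) :
    (((MvPolynomial.X (Sum.inr i) : MvPolynomial (X ⊕ X) K) • c : commSub K A) : A) =
      x K i * c - c * x K i := by
  rw [polySmul_def, actComm_X]; rfl

/-- This is the Jacobi identity, v_i acting as commutation with x_i; it is the Koszul relation among
the generators of the module. -/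
theorem genComm_jacobi (i j k : X) :
    (MvPolynomial.X (Sum.inr i) : MvPolynomial (X ⊕ X) K) • genComm K A k j -
      (MvPolynomial.X (Sum.inr j) : MvPolynomial (X ⊕ X) K) • genComm K A k i =
      (MvPolynomial.X (Sum.inr k) : MvPolynomial (X ⊕ X) K) • genComm K A i j := by
  ext
  simp only [Submodule.coe_sub, coe_X_inr_smul, genComm]
  noncomm_ring

/-- The submodule is closed under left and right multiplication by A, since the generators x_j act
through u_j and u_j - v_j. The Leibniz rule [ab, c] = a[b, c] + [a, c]b, used in each argument in
turn, then reduces every commutator to those of generators. -/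
theorem span_genComm : Submodule.span (MvPolynomial (X ⊕ X) K)
    (Set.range fun p : X × X => genComm K A p.1 p.2) = ⊤ := by
  set P := Submodule.span (MvPolynomial (X ⊕ X) K) (Set.range fun p : X × X => genComm K A p.1 p.2)
  have hK : ∀ (r : K) (c : commSub K A), c ∈ P → r • c ∈ P := by
    intro r c hc
    rw [← algebraMap_smul (MvPolynomial (X ⊕ X) K) r c]
    exact P.smul_mem _ hc
  have hl : ∀ (a : A) (c : commSub K A), c ∈ P → leftEnd a c ∈ P := by
    intro a
    induction mem_adjoin_x K X a using Algebra.adjoin_induction with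
    | algebraMap r =>
      intro c hc
      convert hK r c hc using 1
      ext; simp [Algebra.smul_def]
    | mem _ h =>
      obtain ⟨j, rfl⟩ := h
      intro c hc
      convert P.smul_mem (MvPolynomial.X (Sum.inl j)) hc using 1
      ext; simp [coe_X_inl_smul]
    | mul a b _ _ ha hb =>
      intro c hc
      convert ha _ (hb _ hc) using 1
      ext; simp [mul_assoc]
    | add a b _ _ ha hb =>
      intro c hc
      convert P.add_mem (ha _ hc) (hb _ hc) using 1
      ext; simp [add_mul]
  have hr : ∀ (a : A) (c : commSub K A), c ∈ P → rightEnd a c ∈ P := by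
    intro a
    induction mem_adjoin_x K X a using Algebra.adjoin_induction with
    | algebraMap r =>
      intro c hc
      convert hK r c hc using 1
      ext; simp [Algebra.smul_def, Algebra.commutes]
    | mem _ h =>
      obtain ⟨j, rfl⟩ := h
      intro c hc
      convert P.sub_mem (P.smul_mem (MvPolynomial.X (Sum.inl j)) hc)
        (P.smul_mem (MvPolynomial.X (Sum.inr j)) hc) using 1
      ext; simp [coe_X_inl_smul, coe_X_inr_smul]
    | mul a b _ _ ha hb =>
      intro c hc
      convert hb _ (ha _ hc) using 1
      ext; simp [mul_assoc]
    | add a b _ _ ha hb =>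
      intro c hc
      convert P.add_mem (ha _ hc) (hb _ hc) using 1
      ext; simp [mul_add]
  have hc1 : ∀ f (j : X), (⟨_, commutator_mem f (x K j : A)⟩ : commSub K A) ∈ P := by
    intro f j
    induction mem_adjoin_x K X f using Algebra.adjoin_induction with
    | algebraMap r =>
      convert P.zero_mem using 1
      ext; simp [Algebra.commutes]
    | mem _ h =>
      obtain ⟨i, rfl⟩ := h
      exact Submodule.subset_span ⟨(i, j), rfl⟩
    | mul a b _ _ ha hb =>
      convert P.add_mem (hl a _ hb) (hr b _ ha) using 1
      ext; simp only [Submodule.coe_add, coe_leftEnd, coe_rightEnd]; noncomm_ring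
    | add a b _ _ ha hb =>
      convert P.add_mem ha hb using 1
      ext; simp only [Submodule.coe_add]; noncomm_ring
  have hc2 : ∀ f g, (⟨_, commutator_mem f g⟩ : commSub K A) ∈ P := by
    intro f g
    induction mem_adjoin_x K X g using Algebra.adjoin_induction with
    | algebraMap r =>
      convert P.zero_mem using 1
      ext; simp [Algebra.commutes]
    | mem _ h =>
      obtain ⟨j, rfl⟩ := h
      exact hc1 f j
    | mul a b _ _ ha hb =>
      convert P.add_mem (hl a _ hb) (hr b _ ha) using 1
      ext; simp only [Submodule.coe_add, coe_leftEnd, coe_rightEnd]; noncomm_ring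
    | add a b _ _ ha hb =>
      convert P.add_mem ha hb using 1
      ext; simp only [Submodule.coe_add]; noncomm_ring
  have key : ∀ c ∈ ringCommutatorIdeal A, ∃ h : c ∈ commSub K A, (⟨c, h⟩ : commSub K A) ∈ P := by
    intro c hc
    induction hc using TwoSidedIdeal.span_induction with
    | mem x hx => obtain ⟨f, g, rfl⟩ := hx; exact ⟨_, hc2 f g⟩
    | zero => exact ⟨zero_mem _, P.zero_mem⟩
    | add x y _ _ hx hy =>
      obtain ⟨h1, h2⟩ := hx
      obtain ⟨h3, h4⟩ := hy
      exact ⟨add_mem h1 h3, P.add_mem h2 h4⟩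
    | neg x _ hx =>
      obtain ⟨h1, h2⟩ := hx
      exact ⟨neg_mem h1, P.neg_mem h2⟩
    | left_absorb a x _ hx =>
      obtain ⟨h1, h2⟩ := hx
      exact ⟨mul_mem_commSub a h1, hl a _ h2⟩
    | right_absorb b x _ hx =>
      obtain ⟨h1, h2⟩ := hx
      exact ⟨commSub_mul_mem b h1, hr b _ h2⟩
  rw [eq_top_iff]
  rintro ⟨c, hc⟩ -
  exact (key c hc).2

end

end FreeMetabelian

end
-- Fox calculus and the two homotopy formulas.
noncomputable section

namespace FreeMetabelian

open MvPolynomial MagnusModel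

/-- The polynomials whose monomials have weight `k` with `k + n = m`. -/
def shiftedComponent (K : Type*) [Field K] {σ τ : Type*} (w : σ → (τ →₀ ℕ)) (n m : τ →₀ ℕ) :
    Submodule K (MvPolynomial σ K) where
  carrier := {f | ∀ s, coeff s f ≠ 0 → Finsupp.weight w s + n = m}
  zero_mem' := by simp
  add_mem' := by
    intro f g hf hg s hs
    rw [coeff_add] at hs
    by_cases h : coeff s f = 0
    · exact hg s fun h' => hs (by rw [h, h', add_zero])
    · exact hf s h
  smul_mem' := by
    intro c f hf s hs
    rw [coeff_smul, smul_eq_mul] at hs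
    exact hf s (right_ne_zero_of_mul hs)

section Shifted

variable {K : Type*} [Field K] {σ τ : Type*} {w : σ → (τ →₀ ℕ)}

theorem mem_shiftedComponent {n m : τ →₀ ℕ} {f : MvPolynomial σ K} :
    f ∈ shiftedComponent K w n m ↔ ∀ s, coeff s f ≠ 0 → Finsupp.weight w s + n = m := Iff.rfl

theorem mem_shiftedComponent_zero {m : τ →₀ ℕ} {f : MvPolynomial σ K} :
    f ∈ shiftedComponent K w 0 m ↔ f ∈ weightedHomogeneousSubmodule K w m := by
  simp [mem_shiftedComponent, mem_weightedHomogeneousSubmodule, IsWeightedHomogeneous]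

theorem shiftedComponent_add (n m k : τ →₀ ℕ) :
    shiftedComponent K w (n + k) (m + k) = shiftedComponent K w n m := by
  ext f
  simp [mem_shiftedComponent, ← add_assoc]

theorem shiftedComponent_add_eq (n m : τ →₀ ℕ) :
    shiftedComponent K w n (m + n) = weightedHomogeneousSubmodule K w m := by
  ext f
  rw [← mem_shiftedComponent_zero, ← shiftedComponent_add 0 m n, zero_add]

theorem mul_mem_shiftedComponent {f g : MvPolynomial σ K} {k n m : τ →₀ ℕ}
    (hf : f ∈ weightedHomogeneousSubmodule K w k) (hg : g ∈ shiftedComponent K w n m) :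
    f * g ∈ shiftedComponent K w n (k + m) := by
  classical
  intro s hs
  rw [coeff_mul] at hs
  obtain ⟨⟨a, b⟩, hab, h⟩ := Finset.exists_ne_zero_of_sum_ne_zero hs
  rw [Finset.HasAntidiagonal.mem_antidiagonal] at hab
  rw [← hab, map_add, add_assoc, hg b (right_ne_zero_of_mul h),
    (mem_weightedHomogeneousSubmodule _ _ _ _).1 hf (left_ne_zero_of_mul h)]

theorem X_mem_weightedHomogeneousSubmodule (i : σ) :
    (MvPolynomial.X i : MvPolynomial σ K) ∈ weightedHomogeneousSubmodule K w (w i) :=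
  isWeightedHomogeneous_X K w i

theorem pderiv_mem_shiftedComponent {f : MvPolynomial σ K} {n m : τ →₀ ℕ} (i : σ)
    (hf : f ∈ shiftedComponent K w n m) :
    pderiv i f ∈ shiftedComponent K w (w i + n) m := by
  intro s hs
  rw [coeff_pderiv] at hs
  have := hf _ (left_ne_zero_of_mul hs)
  rw [map_add, Finsupp.weight_single, one_smul] at this
  rw [← this, add_assoc]

/-- Dividing by a variable raises the offset n and leaves m alone, so truncated subtraction of
multidegrees never occurs. -/
theorem X_mul_mem_shiftedComponent_iff {f : MvPolynomial σ K} {n m : τ →₀ ℕ} (i : σ) :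
    MvPolynomial.X i * f ∈ shiftedComponent K w n m ↔ f ∈ shiftedComponent K w (w i + n) m := by
  constructor
  · intro h s hs
    have := h (Finsupp.single i 1 + s) (by rwa [coeff_X_mul])
    rw [← this, map_add, Finsupp.weight_single, one_smul]
    abel
  · intro h s hs
    classical
    rw [coeff_X_mul'] at hs
    split_ifs at hs with hi
    · rw [← h _ hs]
      rw [Finsupp.mem_support_iff] at hi
      rw [← Finsupp.weight_sub_single_add (w := w) hi]
      abel
    · exact absurd rfl hs

end Shifted

/-- The extension of the derivation `δ` of `K[U, V]` to `K[U, V] ⊗ K X`. -/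
def foxDer {K : Type*} [Field K] {X : Type*} [Fintype X] (α : Matrix X X K) :
    (X → MvPolynomial (X ⊕ X) K) →ₗ[K] (X → MvPolynomial (X ⊕ X) K) :=
  LinearMap.pi fun j => (polyDer α).toLinearMap ∘ₗ LinearMap.proj j +
    ∑ i, α j i • LinearMap.proj i

/-- The map `K[U, V] ⊗ K X → K[U, V]` with `x_j ↦ v_j`. -/
def foxSum (K : Type*) [Field K] (X : Type*) [Fintype X] :
    (X → MvPolynomial (X ⊕ X) K) →ₗ[K] MvPolynomial (X ⊕ X) K :=
  ∑ j, LinearMap.mulLeft K (MvPolynomial.X (Sum.inr j)) ∘ₗ LinearMap.proj j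

/-- The homogeneous components of `K[U, V] ⊗ K X`. -/
def foxComponent (K : Type*) [Field K] {X τ : Type*} (w : X → (τ →₀ ℕ)) (m : τ →₀ ℕ) :
    Submodule K (X → MvPolynomial (X ⊕ X) K) :=
  Submodule.pi Set.univ fun j => shiftedComponent K (Sum.elim w w) (w j) m

section

variable {K : Type*} [Field K] {X : Type*}

theorem mem_foxComponent {τ : Type*} {w : X → (τ →₀ ℕ)} {m : τ →₀ ℕ}
    {z : X → MvPolynomial (X ⊕ X) K} :
    z ∈ foxComponent K w m ↔ ∀ j, z j ∈ shiftedComponent K (Sum.elim w w) (w j) m := by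
  simp [foxComponent, Submodule.mem_pi]

variable [Fintype X]

theorem foxDer_apply (α : Matrix X X K) (z : X → MvPolynomial (X ⊕ X) K) (j : X) :
    foxDer α z j = polyDer α (z j) + ∑ i, α j i • z i := by
  simp [foxDer]

theorem foxSum_apply (z : X → MvPolynomial (X ⊕ X) K) :
    foxSum K X z = ∑ j, MvPolynomial.X (Sum.inr j) * z j := by
  simp [foxSum]

/-- The `δ`-constants of multidegree `m` in the kernel of `K[U, V] ⊗ K X → K[U, V]`. -/
def foxConstants {τ : Type*} (α : Matrix X X K) (w : X → (τ →₀ ℕ)) (m : τ →₀ ℕ) :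
    Submodule K (X → MvPolynomial (X ⊕ X) K) :=
  LinearMap.ker (foxSum K X) ⊓ LinearMap.ker (foxDer α) ⊓ foxComponent K w m

theorem mem_foxConstants {τ : Type*} {α : Matrix X X K} {w : X → (τ →₀ ℕ)} {m : τ →₀ ℕ}
    {z : X → MvPolynomial (X ⊕ X) K} : z ∈ foxConstants α w m ↔
      foxSum K X z = 0 ∧ foxDer α z = 0 ∧ z ∈ foxComponent K w m := by
  simp [foxConstants, and_assoc]

end

section Model

variable {K A : Type*} [Field K] [Ring A] [Algebra K A]
variable {X : Type*} [DecidableEq X] [MagnusModel K X A]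

theorem fox_algebraMap (r : K) : fox (algebraMap K A r) = (0 : X → MvPolynomial (X ⊕ X) K) := by
  have h1 : fox (1 : A) = (0 : X → MvPolynomial (X ⊕ X) K) := by
    funext j
    have := fox_mul (K := K) (1 : A) 1 j
    simpa using this
  rw [Algebra.algebraMap_eq_smul_one, map_smul, h1, smul_zero]

/-- The fundamental formula of Fox calculus: both sides obey the same twisted Leibniz rule and equal
v_j at x_j. -/
theorem foxSum_fox [Fintype X] (f : A) : foxSum K X (fox f) = left f - right f := by
  induction mem_adjoin_x K X f using Algebra.adjoin_induction with
  | mem _ h => obtain ⟨j, rfl⟩ := h; simp [foxSum_apply, fox_x, left_x, right_x, Pi.single_apply]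
  | algebraMap r => simp [fox_algebraMap, AlgHom.commutes]
  | add a b _ _ ha hb => simp only [map_add, ha, hb]; ring
  | mul a b _ _ ha hb =>
    have : foxSum K X (fox (a * b)) =
        left a * foxSum K X (fox b) + foxSum K X (fox a) * right b := by
      simp only [foxSum_apply, fox_mul, mul_add, Finset.sum_add_distrib, Finset.mul_sum,
        Finset.sum_mul]
      congr 1 <;> exact Finset.sum_congr rfl fun _ _ => by ring
    rw [this, ha, hb, map_mul, map_mul]
    ring

theorem foxSum_fox_comm [Fintype X] (c : commSub K A) : foxSum K X (fox (c : A)) = 0 := by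
  rw [foxSum_fox, algHom_commSub left c.2, algHom_commSub right c.2, sub_zero]

theorem left_derivation [Fintype X] (α : Matrix X X K) (d : A →ₗ[K] A)
    (hd : ∀ f g, d (f * g) = d f * g + f * d g)
    (hx : ∀ j : X, d (x K j) = ∑ i, α i j • (x K i : A)) (f : A) :
    left (d f) = polyDer α (left f : MvPolynomial (X ⊕ X) K) := by
  have h1 : d 1 = 0 := by simpa using hd 1 1
  induction mem_adjoin_x K X f using Algebra.adjoin_induction with
  | mem _ h => obtain ⟨j, rfl⟩ := h; simp [hx, left_x, polyDer_X_inl]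
  | algebraMap r => simp [Algebra.algebraMap_eq_smul_one, h1]
  | add a b _ _ ha hb => simp only [map_add, ha, hb]
  | mul a b _ _ ha hb =>
    rw [hd, map_add, map_mul, map_mul, ha, hb, map_mul, Derivation.leibniz, smul_eq_mul,
      smul_eq_mul]
    ring

theorem right_derivation [Fintype X] (α : Matrix X X K) (d : A →ₗ[K] A)
    (hd : ∀ f g, d (f * g) = d f * g + f * d g)
    (hx : ∀ j : X, d (x K j) = ∑ i, α i j • (x K i : A)) (f : A) :
    right (d f) = polyDer α (right f : MvPolynomial (X ⊕ X) K) := by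
  have h1 : d 1 = 0 := by simpa using hd 1 1
  induction mem_adjoin_x K X f using Algebra.adjoin_induction with
  | mem _ h =>
    obtain ⟨j, rfl⟩ := h
    simp [hx, right_x, polyDer_X_inl, polyDer_X_inr, smul_sub]
  | algebraMap r => simp [Algebra.algebraMap_eq_smul_one, h1]
  | add a b _ _ ha hb => simp only [map_add, ha, hb]
  | mul a b _ _ ha hb =>
    rw [hd, map_add, map_mul, map_mul, ha, hb, map_mul, Derivation.leibniz, smul_eq_mul,
      smul_eq_mul]
    ring

/-- Since `left` and `right` intertwine the derivations, both sides obey the same Leibniz rule. The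
matrix term of `foxDer` is the action of δ on the tensor factor KX. -/
theorem fox_derivation [Fintype X] (α : Matrix X X K) (d : A →ₗ[K] A)
    (hd : ∀ f g, d (f * g) = d f * g + f * d g)
    (hx : ∀ j : X, d (x K j) = ∑ i, α i j • (x K i : A)) (f : A) :
    fox (d f) = foxDer α (fox f) := by
  have h1 : d 1 = 0 := by simpa using hd 1 1
  induction mem_adjoin_x K X f using Algebra.adjoin_induction with
  | mem _ h =>
    obtain ⟨j, rfl⟩ := h
    funext k
    simp [hx, fox_x, foxDer_apply, Pi.single_apply, apply_ite (polyDer α)]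
  | algebraMap r => rw [fox_algebraMap, Algebra.algebraMap_eq_smul_one, map_smul, h1]; simp
  | add a b _ _ ha hb => simp only [map_add, ha, hb]
  | mul a b _ _ ha hb =>
    funext k
    rw [hd, map_add, Pi.add_apply, fox_mul, fox_mul, ha, hb, left_derivation α d hd hx,
      right_derivation α d hd hx]
    simp only [foxDer_apply, fox_mul, map_add, Derivation.leibniz, smul_eq_mul, mul_add, add_mul,
      smul_add, Finset.sum_add_distrib, Finset.mul_sum, Finset.sum_mul, mul_smul_comm,
      smul_mul_assoc]
    ring

theorem derivation_mem_commSub (d : A →ₗ[K] A) (hd : ∀ f g, d (f * g) = d f * g + f * d g)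
    {c : A} (hc : c ∈ commSub K A) : d c ∈ commSub K A := by
  have key : ∀ c ∈ ringCommutatorIdeal A, c ∈ commSub K A ∧ d c ∈ commSub K A := by
    intro c hc
    induction hc using TwoSidedIdeal.span_induction with
    | mem x hx =>
      obtain ⟨f, g, rfl⟩ := hx
      refine ⟨commutator_mem f g, ?_⟩
      have : d (f * g - g * f) = (d f * g - g * d f) + (f * d g - d g * f) := by
        rw [map_sub, hd, hd]; abel
      rw [this]
      exact add_mem (commutator_mem _ _) (commutator_mem _ _)
    | zero => simp
    | add x y _ _ hx hy => exact ⟨add_mem hx.1 hy.1, by rw [map_add]; exact add_mem hx.2 hy.2⟩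
    | neg x _ hx => exact ⟨neg_mem hx.1, by rw [map_neg]; exact neg_mem hx.2⟩
    | left_absorb a x _ hx =>
      exact ⟨mul_mem_commSub _ hx.1, by
        rw [hd]; exact add_mem (mul_mem_commSub _ hx.1) (mul_mem_commSub _ hx.2)⟩
    | right_absorb b x _ hx =>
      exact ⟨commSub_mul_mem _ hx.1, by
        rw [hd]; exact add_mem (commSub_mul_mem _ hx.2) (commSub_mul_mem _ hx.1)⟩
  exact (key c hc).2

theorem fox_genComm (i j : X) : fox (genComm K A i j : A) =
    Pi.single j (MvPolynomial.X (Sum.inr i)) -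
      (Pi.single i (MvPolynomial.X (Sum.inr j)) : X → MvPolynomial (X ⊕ X) K) := by
  funext k
  rw [genComm, map_sub, Pi.sub_apply, fox_mul, fox_mul, fox_x, fox_x]
  simp only [left_x, right_x, Pi.single_apply, Pi.sub_apply]
  split_ifs <;> ring

variable [IsMetabelianRing A]

/-- `left` and `right` vanish on the commutator ideal, so only one term of each Leibniz rule
survives: x_j acts as u_j from the left and as u_j - v_j from the right. -/
theorem fox_smul (h : MvPolynomial (X ⊕ X) K) (c : commSub K A) :
    fox ((h • c : commSub K A) : A) = h • (fox (c : A) : X → MvPolynomial (X ⊕ X) K) := by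
  induction h using MvPolynomial.induction_on generalizing c with
  | C a =>
    have : (C a : MvPolynomial (X ⊕ X) K) • c = a • c := by
      rw [← algebraMap_eq, algebraMap_smul]
    rw [this, Submodule.coe_smul, map_smul]
    funext j
    simp [C_mul']
  | add p q hp hq => rw [add_smul, Submodule.coe_add, map_add, hp, hq, add_smul]
  | mul_X p i hp =>
    rw [mul_smul, hp, mul_smul]
    congr 1
    funext j
    cases i with
    | inl i =>
      rw [coe_X_inl_smul, fox_mul, algHom_commSub right c.2, left_x]
      simp
    | inr i =>
      rw [coe_X_inr_smul, map_sub, Pi.sub_apply, fox_mul, fox_mul, algHom_commSub right c.2,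
        algHom_commSub left c.2, left_x, right_x]
      simp only [Pi.smul_apply, smul_eq_mul]
      ring

variable (K A X) in
/-- The map from `K[U, V] ⊗ K X` to the commutator ideal which is, on the image of the commutator
ideal under the Fox derivatives, inverse to them up to the Euler derivation. -/
def magnusInv [Fintype X] : (X → MvPolynomial (X ⊕ X) K) →ₗ[K] commSub K A where
  toFun z := ∑ j, ∑ i, pderiv (Sum.inr i) (z j) • genComm K A i j
  map_add' y z := by simp [add_smul, Finset.sum_add_distrib]
  map_smul' r z := by simp [Finset.smul_sum]

theorem magnusInv_apply [Fintype X] (z : X → MvPolynomial (X ⊕ X) K) :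
    magnusInv K A X z = ∑ j, ∑ i, pderiv (Sum.inr i) (z j) • genComm K A i j := rfl

theorem magnusInv_single [Fintype X] (j : X) (g : MvPolynomial (X ⊕ X) K) :
    magnusInv K A X (Pi.single j g) = ∑ i, pderiv (Sum.inr i) g • genComm K A i j := by
  rw [magnusInv_apply, Finset.sum_eq_single j]
  · simp
  · intro b _ hb; simp [Pi.single_eq_of_ne hb]
  · simp

/-- Homotopy formula in Koszul degree 1. Differentiating ∑ v_j z_j = 0 by v_k gives ∑ v_j ∂z_j/∂v_k
= -z_k, which is the source of the summand z_k besides E z_k. -/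
theorem fox_magnusInv [Fintype X] (z : X → MvPolynomial (X ⊕ X) K) (hz : foxSum K X z = 0) (k : X) :
    fox (magnusInv K A X z : A) k = eulerV K X (z k) + z k := by
  have h1 : pderiv (Sum.inr k) (foxSum K X z) = 0 := by rw [hz, map_zero]
  simp only [foxSum_apply, map_sum, Derivation.leibniz, pderiv_X, smul_eq_mul,
    Finset.sum_add_distrib] at h1
  have h2 : ∑ j, z j * (Pi.single (Sum.inr k) 1 : X ⊕ X → MvPolynomial (X ⊕ X) K) (Sum.inr j) =
      z k := by
    rw [Finset.sum_eq_single k] <;> simp +contextual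
  rw [magnusInv_apply, AddSubmonoidClass.coe_finsetSum, map_sum, Finset.sum_apply]
  simp only [AddSubmonoidClass.coe_finsetSum, map_sum, Finset.sum_apply, fox_smul, fox_genComm,
    Pi.smul_apply, Pi.sub_apply, smul_eq_mul, mul_sub, Finset.sum_sub_distrib]
  rw [eulerV_eq_sum]
  have h3 : ∑ j, ∑ i, pderiv (Sum.inr i) (z j) *
      (Pi.single j (MvPolynomial.X (Sum.inr i)) : X → MvPolynomial (X ⊕ X) K) k =
      ∑ i, MvPolynomial.X (Sum.inr i) * pderiv (Sum.inr i) (z k) := by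
    rw [Finset.sum_eq_single k]
    · simp [mul_comm]
    · intro b _ hb; simp [Pi.single_eq_of_ne hb.symm]
    · simp
  have h4 : ∑ j, ∑ i, pderiv (Sum.inr i) (z j) *
      (Pi.single i (MvPolynomial.X (Sum.inr j)) : X → MvPolynomial (X ⊕ X) K) k =
      ∑ j, MvPolynomial.X (Sum.inr j) * pderiv (Sum.inr k) (z j) := by
    refine Finset.sum_congr rfl fun j _ => ?_
    rw [Finset.sum_eq_single k]
    · simp [mul_comm]
    · intro b _ hb; simp [Pi.single_eq_of_ne hb.symm]
    · simp
  rw [h3, h4, eq_neg_of_add_eq_zero_left h1, h2]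
  ring

/-- Homotopy formula in Koszul degree 2, which explains the constant 2. It is stated on generators
of the module since coefficients with respect to them are not unique. -/
theorem magnusInv_fox_smul [Fintype X] (h : MvPolynomial (X ⊕ X) K) (i j : X) :
    magnusInv K A X (fox ((h • genComm K A i j : commSub K A) : A)) =
      (eulerV K X h + (2 : K) • h) • genComm K A i j := by
  have h0 : (h • fox (genComm K A i j : A) : X → MvPolynomial (X ⊕ X) K) =
      Pi.single j (h * MvPolynomial.X (Sum.inr i)) -
        Pi.single i (h * MvPolynomial.X (Sum.inr j)) := by
    rw [fox_genComm, smul_sub, ← Pi.single_smul, ← Pi.single_smul, smul_eq_mul, smul_eq_mul]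
  have h1 : ∀ a b : X, magnusInv K A X (Pi.single b (h * MvPolynomial.X (Sum.inr a))) =
      h • genComm K A a b + ∑ k, pderiv (Sum.inr k) h •
        (MvPolynomial.X (Sum.inr a) : MvPolynomial (X ⊕ X) K) • genComm K A k b := by
    intro a b
    rw [magnusInv_single]
    simp only [Derivation.leibniz, pderiv_X, smul_eq_mul, add_smul, Finset.sum_add_distrib]
    congr 1
    · rw [Finset.sum_eq_single a]
      · simp
      · intro k _ hk; simp [hk.symm]
      · simp
    · refine Finset.sum_congr rfl fun k _ => ?_
      rw [mul_comm, mul_smul]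
  rw [fox_smul, h0, map_sub, h1, h1, add_sub_add_comm, ← Finset.sum_sub_distrib]
  -- Jacobi turns the derivative terms into ∑ (∂h/∂v_k) v_k [x_i, x_j] = (E h)[x_i, x_j];
  -- antisymmetry adds the two remaining copies of h[x_i, x_j].
  simp only [← smul_sub, genComm_jacobi]
  rw [genComm_swap i j, eulerV_eq_sum, add_smul, Finset.sum_smul, two_smul, add_smul,
    sub_neg_eq_add, add_comm]
  congr 1
  · refine Finset.sum_congr rfl fun k _ => ?_
    rw [mul_comm, mul_smul]
  · rw [smul_add]

end Model

end FreeMetabelian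

end
-- Bijectivity of the Fox map from the commutator ideal onto the kernel, degree by degree.
noncomputable section

namespace FreeMetabelian

open MvPolynomial MagnusModel

/-- The homogeneous components of an algebra generated by `x_j`, `j ∈ X`. -/
def magnusComponent (K A : Type*) [Field K] [Ring A] [Algebra K A] {X τ : Type*} [DecidableEq X]
    [MagnusModel K X A] (w : X → (τ →₀ ℕ)) (m : τ →₀ ℕ) : Submodule K A :=
  Submodule.span K {f | ∃ l : List X, (l.map w).sum = m ∧ f = (l.map (x K)).prod}

section Model

variable {K A : Type*} [Field K] [Ring A] [Algebra K A]
variable {X : Type*} [DecidableEq X] [MagnusModel K X A]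

section Component

variable {τ : Type*} {w : X → (τ →₀ ℕ)}

theorem x_mul_mem_magnusComponent (j : X) {m : τ →₀ ℕ} {f : A}
    (hf : f ∈ magnusComponent K A w m) : x K j * f ∈ magnusComponent K A w (w j + m) := by
  induction hf using Submodule.span_induction with
  | mem f hf =>
    obtain ⟨l, rfl, rfl⟩ := hf
    exact Submodule.subset_span ⟨j :: l, by simp, by simp⟩
  | zero => simp
  | add a b _ _ ha hb => rw [mul_add]; exact add_mem ha hb
  | smul r a _ ha => rw [mul_smul_comm]; exact Submodule.smul_mem _ _ ha

theorem mul_x_mem_magnusComponent (j : X) {m : τ →₀ ℕ} {f : A}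
    (hf : f ∈ magnusComponent K A w m) : f * x K j ∈ magnusComponent K A w (w j + m) := by
  induction hf using Submodule.span_induction with
  | mem f hf =>
    obtain ⟨l, rfl, rfl⟩ := hf
    exact Submodule.subset_span ⟨l ++ [j], by simp [add_comm], by simp⟩
  | zero => simp
  | add a b _ _ ha hb => rw [add_mul]; exact add_mem ha hb
  | smul r a _ ha => rw [smul_mul_assoc]; exact Submodule.smul_mem _ _ ha

theorem genComm_mem_magnusComponent (i j : X) :
    (genComm K A i j : A) ∈ magnusComponent K A w (w i + w j) := by
  refine sub_mem (Submodule.subset_span ⟨[i, j], by simp, by simp⟩)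
    (Submodule.subset_span ⟨[j, i], by simp [add_comm], by simp⟩)

theorem right_word_mem (l : List X) : right (l.map (x K) : List A).prod ∈
    weightedHomogeneousSubmodule K (Sum.elim w w) (l.map w).sum := by
  induction l with
  | nil => simpa using isWeightedHomogeneous_one K (Sum.elim w w)
  | cons i l ih =>
    simp only [List.map_cons, List.prod_cons, List.sum_cons, map_mul, right_x]
    exact ((isWeightedHomogeneous_X K (Sum.elim w w) (Sum.inl i)).sub
      (isWeightedHomogeneous_X K (Sum.elim w w) (Sum.inr i))).mul ih

theorem fox_word_mem (l : List X) : fox (l.map (x K) : List A).prod ∈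
    foxComponent K w (l.map w).sum := by
  induction l with
  | nil =>
    have := fox_algebraMap (K := K) (A := A) (X := X) 1
    rw [map_one] at this
    simp [this]
  | cons i l ih =>
    rw [mem_foxComponent] at ih ⊢
    intro j
    simp only [List.map_cons, List.prod_cons, List.sum_cons, fox_mul, left_x, fox_x]
    refine add_mem (mul_mem_shiftedComponent (X_mem_weightedHomogeneousSubmodule (Sum.inl i))
      (ih j)) ?_
    rcases eq_or_ne j i with rfl | h
    · rw [Pi.single_eq_same, one_mul, add_comm, shiftedComponent_add_eq]
      exact right_word_mem l
    · simp [Pi.single_eq_of_ne h]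

theorem fox_mem_foxComponent {m : τ →₀ ℕ} {f : A} (hf : f ∈ magnusComponent K A w m) :
    (fox f : X → MvPolynomial (X ⊕ X) K) ∈ foxComponent K w m := by
  induction hf using Submodule.span_induction with
  | mem f hf =>
    obtain ⟨l, rfl, rfl⟩ := hf
    exact fox_word_mem l
  | zero => simp
  | add a b _ _ ha hb => rw [map_add]; exact add_mem ha hb
  | smul r a _ ha => rw [map_smul]; exact Submodule.smul_mem _ _ ha

variable [IsMetabelianRing A]

theorem monomial_smul_mem_magnusComponent (s : X ⊕ X →₀ ℕ) (r : K) (c : commSub K A) {n : τ →₀ ℕ}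
    (hc : (c : A) ∈ magnusComponent K A w n) :
    ((monomial s r • c : commSub K A) : A) ∈
      magnusComponent K A w (Finsupp.weight (Sum.elim w w) s + n) := by
  have hX : ∀ (i : X ⊕ X) (c : commSub K A) (n : τ →₀ ℕ), (c : A) ∈ magnusComponent K A w n →
      (((MvPolynomial.X i : MvPolynomial (X ⊕ X) K) • c : commSub K A) : A) ∈
        magnusComponent K A w (Sum.elim w w i + n) := by
    intro i c n hc
    cases i with
    | inl i => rw [coe_X_inl_smul]; exact x_mul_mem_magnusComponent i hc
    | inr i =>
      rw [coe_X_inr_smul]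
      exact sub_mem (x_mul_mem_magnusComponent i hc) (mul_x_mem_magnusComponent i hc)
  induction s using Finsupp.induction_linear generalizing r c n with
  | zero =>
    have : (C r : MvPolynomial (X ⊕ X) K) • c = r • c := by
      rw [← algebraMap_eq, algebraMap_smul]
    rw [← MvPolynomial.C_apply, this, map_zero, zero_add]
    exact Submodule.smul_mem _ _ hc
  | add s t hs ht =>
    have : monomial (s + t) r = monomial s r * monomial t (1 : K) := by simp [monomial_mul]
    rw [this, mul_smul, map_add, add_assoc]
    exact hs _ _ (ht _ _ hc)
  | single i k =>
    induction k generalizing n c with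
    | zero =>
      have : (C r : MvPolynomial (X ⊕ X) K) • c = r • c := by
        rw [← algebraMap_eq, algebraMap_smul]
      rw [Finsupp.single_zero, ← MvPolynomial.C_apply, this, map_zero, zero_add]
      exact Submodule.smul_mem _ _ hc
    | succ k ih =>
      have h1 : monomial (Finsupp.single i (k + 1)) r =
          monomial (Finsupp.single i k) r * MvPolynomial.X i := by
        rw [MvPolynomial.X, monomial_mul, mul_one, ← Finsupp.single_add]
      rw [h1, mul_smul, Finsupp.single_add, map_add, add_assoc]
      convert ih _ (hX i c n hc) using 3
      simp [Finsupp.weight_single]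

theorem smul_mem_magnusComponent {n m : τ →₀ ℕ} {h : MvPolynomial (X ⊕ X) K}
    (hh : h ∈ shiftedComponent K (Sum.elim w w) n m) (c : commSub K A)
    (hc : (c : A) ∈ magnusComponent K A w n) :
    ((h • c : commSub K A) : A) ∈ magnusComponent K A w m := by
  rw [h.as_sum, Finset.sum_smul, AddSubmonoidClass.coe_finsetSum]
  refine Submodule.sum_mem _ fun s hs => ?_
  rw [← hh s (mem_support_iff.1 hs)]
  exact monomial_smul_mem_magnusComponent s _ c hc

theorem magnusInv_mem_magnusComponent [Fintype X] {m : τ →₀ ℕ} {z : X → MvPolynomial (X ⊕ X) K}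
    (hz : z ∈ foxComponent K w m) :
    (magnusInv K A X z : A) ∈ magnusComponent K A w m := by
  rw [mem_foxComponent] at hz
  rw [magnusInv_apply, AddSubmonoidClass.coe_finsetSum]
  refine Submodule.sum_mem _ fun j _ => ?_
  rw [AddSubmonoidClass.coe_finsetSum]
  refine Submodule.sum_mem _ fun i _ => ?_
  exact smul_mem_magnusComponent (pderiv_mem_shiftedComponent (Sum.inr i) (hz j)) _
    (genComm_mem_magnusComponent i j)

end Component

variable [IsMetabelianRing A] [Fintype X] [CharZero K]

/-- Write c = ∑ h_p g_p in the generators g_p = [x_i, x_j], solve (E + 2) h'_p = h_p and put c' = ∑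
h'_p g_p. Then `magnusInv` sends the Fox image of c' to c. As the Fox image of g_p is linear in V,
(E + 1) takes the Fox image of c' to that of c, which is zero; E + 1 is injective, so c = 0. -/
theorem eq_zero_of_fox_eq_zero (c : commSub K A)
    (hc : fox (c : A) = (0 : X → MvPolynomial (X ⊕ X) K)) : c = 0 := by
  have hmem : c ∈ Submodule.span (MvPolynomial (X ⊕ X) K)
      (Set.range fun p : X × X => genComm K A p.1 p.2) := by
    rw [span_genComm]; trivial
  obtain ⟨h, rfl⟩ := (Submodule.mem_span_range_iff_exists_fun _).1 hmem
  have hE : ∀ p, ∃ f, eulerV K X f + ((2 : ℕ) : K) • f = h p := fun p =>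
    (exists_eulerV_add_smul_eq 2 (h p) fun s _ => by omega).imp fun f hf => hf.1
  choose h' hh' using hE
  have h1 : magnusInv K A X (fox ((∑ p, h' p • genComm K A p.1 p.2 : commSub K A) : A)) =
      ∑ p, h p • genComm K A p.1 p.2 := by
    rw [AddSubmonoidClass.coe_finsetSum, map_sum, map_sum]
    refine Finset.sum_congr rfl fun p _ => ?_
    rw [magnusInv_fox_smul, ← hh' p, Nat.cast_ofNat]
  have h2 : fox ((∑ p, h' p • genComm K A p.1 p.2 : commSub K A) : A) =
      (0 : X → MvPolynomial (X ⊕ X) K) := by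
    funext k
    refine eulerV_add_smul_injective 1 _ (fun s _ => by omega) ?_
    refine Eq.trans ?_ (congrFun hc k)
    rw [AddSubmonoidClass.coe_finsetSum, AddSubmonoidClass.coe_finsetSum, map_sum, map_sum,
      Finset.sum_apply, Finset.sum_apply, map_sum, Finset.smul_sum, ← Finset.sum_add_distrib]
    refine Finset.sum_congr rfl fun p _ => ?_
    have h4 : eulerV K X (fox (genComm K A p.1 p.2 : A) k) = fox (genComm K A p.1 p.2 : A) k := by
      rw [fox_genComm, Pi.sub_apply, map_sub]
      simp only [Pi.single_apply]
      split_ifs <;> simp [eulerV_X_inr]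
    rw [fox_smul, fox_smul, Pi.smul_apply, Pi.smul_apply, smul_eq_mul, smul_eq_mul,
      Derivation.leibniz, h4, ← hh' p]
    simp only [smul_eq_mul, Nat.cast_one, one_smul, Nat.cast_ofNat, two_smul]
    ring
  rw [← h1, h2, map_zero]

/-- The preimage is `magnusInv` of y = (E + 1)⁻¹ z, once y is known to lie in the kernel of `foxSum`
as well. -/
theorem exists_fox_eq {τ : Type*} {w : X → (τ →₀ ℕ)} {m : τ →₀ ℕ} {z : X → MvPolynomial (X ⊕ X) K}
    (hz : foxSum K X z = 0) (hm : z ∈ foxComponent K w m) :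
    ∃ c : commSub K A, (c : A) ∈ magnusComponent K A w m ∧ fox (c : A) = z := by
  have hE : ∀ j, ∃ f, eulerV K X f + ((1 : ℕ) : K) • f = z j ∧
      ∀ s, coeff s f ≠ 0 → coeff s (z j) ≠ 0 := fun j =>
    exists_eulerV_add_smul_eq 1 (z j) fun s _ => by omega
  choose y hy hs using hE
  have hy0 : foxSum K X y = 0 := by
    -- ∑ v_j y_j lies in K[U, V]_ω, where E itself is injective, and E maps it to ∑ v_j (E + 1) y_j
    -- = ∑ v_j z_j = 0.
    refine eulerV_add_smul_injective 0 _ (fun s hs => ?_) ?_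
    · rw [add_zero]
      refine (killV_eq_zero_iff _).1 ((mem_omegaIdeal_iff _).1 ?_) s hs
      rw [foxSum_apply]
      refine Submodule.sum_mem _ fun j _ => ?_
      rw [mul_comm]
      exact mul_mem_omegaIdeal _ _ (X_inr_mem_omegaIdeal j)
    · rw [Nat.cast_zero, zero_smul, add_zero, ← hz, foxSum_apply, foxSum_apply, map_sum]
      refine Finset.sum_congr rfl fun j _ => ?_
      rw [Derivation.leibniz, eulerV_X_inr, ← hy j]
      simp only [smul_eq_mul, Nat.cast_one, one_smul]
      ring
  refine ⟨magnusInv K A X y, magnusInv_mem_magnusComponent ?_, ?_⟩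
  · rw [mem_foxComponent] at hm ⊢
    exact fun j s h => hm j s (hs j s h)
  · funext k
    rw [fox_magnusInv y hy0, ← hy k, Nat.cast_one, one_smul]

theorem finrank_commSub_eq {τ : Type*} (w : X → (τ →₀ ℕ)) (m : τ →₀ ℕ) (α : Matrix X X K)
    (d : A →ₗ[K] A) (hd : ∀ f g, d (f * g) = d f * g + f * d g)
    (hx : ∀ j : X, d (x K j) = ∑ i, α i j • (x K i : A)) :
    Module.finrank K ↥(commSub K A ⊓ LinearMap.ker d ⊓ magnusComponent K A w m) =
      Module.finrank K ↥(foxConstants α w m) := by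
  have hmap : ∀ f ∈ commSub K A ⊓ LinearMap.ker d ⊓ magnusComponent K A w m,
      (fox f : X → MvPolynomial (X ⊕ X) K) ∈ foxConstants α w m := by
    rintro f ⟨⟨h1, h2⟩, h3⟩
    rw [mem_foxConstants]
    refine ⟨foxSum_fox_comm ⟨f, h1⟩, ?_, fox_mem_foxComponent h3⟩
    rw [← fox_derivation α d hd hx, LinearMap.mem_ker.1 h2, map_zero]
  refine LinearEquiv.finrank_eq (LinearEquiv.ofBijective
    ((fox : A →ₗ[K] X → MvPolynomial (X ⊕ X) K).restrict hmap) ⟨?_, ?_⟩)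
  · rw [← LinearMap.ker_eq_bot, LinearMap.ker_eq_bot']
    rintro ⟨f, hf⟩ h
    have h1 := eq_zero_of_fox_eq_zero (K := K) (X := X) ⟨f, hf.1.1⟩ (congrArg Subtype.val h)
    exact Subtype.ext (show f = 0 from congrArg Subtype.val h1)
  · rintro ⟨z, hz⟩
    obtain ⟨h1, h2, h3⟩ := mem_foxConstants.1 hz
    obtain ⟨c, hc, rfl⟩ := exists_fox_eq (A := A) h1 h3
    refine ⟨⟨c, ⟨c.2, ?_⟩, hc⟩, rfl⟩
    -- The preimage c is a constant because d c is again in the commutator ideal and has zero Fox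
    -- image.
    rw [← fox_derivation α d hd hx] at h2
    exact congrArg Subtype.val (eq_zero_of_fox_eq_zero (X := X)
      ⟨d c, derivation_mem_commSub d hd c.2⟩ h2)

end Model

end FreeMetabelian

end
-- The triangular representation of the free metabelian algebra.
noncomputable section

namespace FreeMetabelian

open MvPolynomial MagnusModel

/-- A homomorphism from the free metabelian algebra to a commutative algebra. -/
def liftComm {K : Type*} [Field K] {X A : Type*} [CommRing A] [Algebra K A] (y : X → A) :
    FreeMet K X →ₐ[K] A :=
  RingQuot.liftAlgHom K ⟨FreeAlgebra.lift K y, by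
    intro u v h
    cases h with
    | mk f g h k => simp only [map_mul, map_sub, map_zero]; ring⟩

/-- The map `x_j ↦ u_j`. -/
def leftMap (K : Type*) [Field K] (X : Type*) : FreeMet K X →ₐ[K] MvPolynomial (X ⊕ X) K :=
  liftComm fun j => MvPolynomial.X (Sum.inl j)

/-- The map `x_j ↦ u_j - v_j`. -/
def rightMap (K : Type*) [Field K] (X : Type*) : FreeMet K X →ₐ[K] MvPolynomial (X ⊕ X) K :=
  liftComm fun j => MvPolynomial.X (Sum.inl j) - MvPolynomial.X (Sum.inr j)

/-- The triangular representation `x_i ↦ (u_i, δ_{ij}; 0, u_i - v_i)` on the free algebra. -/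
def freeTriangular (K : Type*) [Field K] {X : Type*} [DecidableEq X] (j : X) :
    FreeAlgebra K X →ₐ[K] Matrix (Fin 2) (Fin 2) (MvPolynomial (X ⊕ X) K) :=
  FreeAlgebra.lift K fun i => !![MvPolynomial.X (Sum.inl i), if i = j then 1 else 0;
    0, MvPolynomial.X (Sum.inl i) - MvPolynomial.X (Sum.inr i)]

/-- Commutators of upper triangular 2 × 2 matrices over a commutative ring are strictly upper
triangular, so two of them multiply to zero; this is why the representation factors through the
metabelian quotient. -/
theorem freeTriangular_one_zero {K : Type*} [Field K] {X : Type*} [DecidableEq X] (j : X)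
    (f : FreeAlgebra K X) : freeTriangular K j f 1 0 = 0 := by
  induction f using FreeAlgebra.induction with
  | grade0 r => simp [Matrix.algebraMap_matrix_apply]
  | grade1 i => simp [freeTriangular]
  | mul a b ha hb => simp [Matrix.mul_apply, ha, hb]
  | add a b ha hb => simp [ha, hb]

/-- The triangular representation `x_i ↦ (u_i, δ_{ij}; 0, u_i - v_i)`. -/
def triangular (K : Type*) [Field K] {X : Type*} [DecidableEq X] (j : X) :
    FreeMet K X →ₐ[K] Matrix (Fin 2) (Fin 2) (MvPolynomial (X ⊕ X) K) :=
  RingQuot.liftAlgHom K ⟨freeTriangular K j, by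
    intro u v h
    cases h with
    | mk f g h k =>
      have hf := freeTriangular_one_zero j f
      have hg := freeTriangular_one_zero j g
      have hh := freeTriangular_one_zero j h
      have hk := freeTriangular_one_zero j k
      simp only [map_mul, map_sub, map_zero]
      generalize freeTriangular K j f = f at *
      generalize freeTriangular K j g = g at *
      generalize freeTriangular K j h = h at *
      generalize freeTriangular K j k = k at *
      apply Matrix.ext
      refine Fin.forall_fin_two.2 ⟨Fin.forall_fin_two.2 ⟨?_, ?_⟩, Fin.forall_fin_two.2 ⟨?_, ?_⟩⟩ <;>
        simp only [Matrix.mul_apply, Matrix.sub_apply, Matrix.zero_apply, Fin.sum_univ_two, hf, hg,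
          hh, hk] <;> ring⟩

section

variable {K : Type*} [Field K] {X : Type*}

theorem liftComm_gen {A : Type*} [CommRing A] [Algebra K A] (y : X → A) (j : X) :
    liftComm (K := K) y (gen K j) = y j := by
  simp [liftComm, gen]

theorem adjoin_gen : Algebra.adjoin K (Set.range (gen K : X → FreeMet K X)) = ⊤ := by
  rw [eq_top_iff]
  rintro f -
  obtain ⟨f, rfl⟩ := RingQuot.mkAlgHom_surjective K (MetabelianRel K X) f
  induction f using FreeAlgebra.induction with
  | grade0 r => rw [AlgHom.commutes]; exact Subalgebra.algebraMap_mem _ r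
  | grade1 j => exact Algebra.subset_adjoin ⟨j, rfl⟩
  | mul a b ha hb => rw [map_mul]; exact mul_mem ha hb
  | add a b ha hb => rw [map_add]; exact add_mem ha hb

variable [DecidableEq X]

theorem triangular_gen (i j : X) : triangular K j (gen K i) =
    !![MvPolynomial.X (Sum.inl i), if i = j then 1 else 0;
      0, MvPolynomial.X (Sum.inl i) - MvPolynomial.X (Sum.inr i)] := by
  simp [triangular, gen, freeTriangular]

theorem triangular_entries (j : X) (f : FreeMet K X) : triangular K j f 0 0 = leftMap K X f ∧
    triangular K j f 1 0 = 0 ∧ triangular K j f 1 1 = rightMap K X f := by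
  have hf : f ∈ Algebra.adjoin K (Set.range (gen K : X → FreeMet K X)) := by
    rw [adjoin_gen]; trivial
  induction hf using Algebra.adjoin_induction with
  | mem f h =>
    obtain ⟨i, rfl⟩ := h
    simp [triangular_gen, leftMap, rightMap, liftComm_gen]
  | algebraMap r => simp [AlgHom.commutes, Matrix.algebraMap_matrix_apply]
  | add a b _ _ ha hb => simp [ha, hb]
  | mul a b _ _ ha hb => simp [Matrix.mul_apply, Fin.sum_univ_two, ha, hb]

instance : IsMetabelianRing (FreeMet K X) := ⟨metabelian_identity⟩

instance : MagnusModel K X (FreeMet K X) where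
  x := gen K
  adjoin_x := adjoin_gen
  left := leftMap K X
  right := rightMap K X
  fox := LinearMap.pi fun j =>
    { toFun := fun f => triangular K j f 0 1
      map_add' := by simp
      map_smul' := by simp }
  left_x j := liftComm_gen _ _
  right_x j := liftComm_gen _ _
  fox_x i := by
    funext j
    simp [triangular_gen, Pi.single_apply, eq_comm]
  fox_mul f g j := by
    simp [Matrix.mul_apply, Fin.sum_univ_two, triangular_entries]

theorem finrank_commConstants [CharZero K] [Fintype X] {τ : Type*} (α : Matrix X X K)
    (w : X → (τ →₀ ℕ)) (m : τ →₀ ℕ) :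
    Module.finrank K ↥(commConstants α ⊓ component K w m) =
      Module.finrank K ↥(foxConstants α w m) :=
  finrank_commSub_eq (A := FreeMet K X) w m α (linDer α) (der_mul _) (der_gen _)

end

end FreeMetabelian

end
-- Splitting off the variable u_o.
noncomputable section

namespace FreeMetabelian

open MvPolynomial

/-- The substitution `x_i ↦ 0`. -/
def killVar (K : Type*) [Field K] {σ : Type*} [DecidableEq σ] (i : σ) :
    MvPolynomial σ K →ₐ[K] MvPolynomial σ K :=
  aeval fun j => if j = i then 0 else MvPolynomial.X j

section KillVar

variable {K : Type*} [Field K] {σ : Type*} [DecidableEq σ]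

theorem killVar_X_self (i : σ) : killVar K i (MvPolynomial.X i) = 0 := by
  simp [killVar]

theorem killVar_X_of_ne {i j : σ} (h : j ≠ i) :
    killVar K i (MvPolynomial.X j) = MvPolynomial.X j := by
  simp [killVar, h]

theorem killVar_monomial (i : σ) (s : σ →₀ ℕ) (c : K) :
    killVar K i (monomial s c) = if s i = 0 then monomial s c else 0 := by
  induction s using Finsupp.induction_linear generalizing c with
  | zero => simp [killVar, ← MvPolynomial.C_apply, algebraMap_eq]
  | add s t hs ht =>
    have : monomial (s + t) c = monomial s c * monomial t (1 : K) := by simp [monomial_mul]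
    rw [this, map_mul, hs, ht, Finsupp.add_apply]
    by_cases h1 : s i = 0 <;> by_cases h2 : t i = 0 <;> simp [h1, h2]
  | single j n =>
    rw [← C_mul_X_pow_eq_monomial, map_mul, map_pow]
    rcases eq_or_ne j i with rfl | h
    · rcases n with _ | n <;> simp [killVar, algebraMap_eq]
    · simp [killVar, h, algebraMap_eq]

theorem coeff_killVar (i : σ) (s : σ →₀ ℕ) (f : MvPolynomial σ K) :
    coeff s (killVar K i f) = if s i = 0 then coeff s f else 0 := by
  induction f using MvPolynomial.induction_on' with
  | add p q hp hq => simp only [map_add, coeff_add, hp, hq]; split_ifs <;> simp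
  | monomial t c =>
    rw [killVar_monomial, coeff_monomial]
    by_cases h : t = s
    · subst h; split_ifs <;> simp_all
    · split_ifs <;> simp [coeff_monomial, h]

theorem X_dvd_of_killVar_eq_zero {i : σ} {f : MvPolynomial σ K} (h : killVar K i f = 0) :
    MvPolynomial.X i ∣ f := by
  rw [f.as_sum]
  refine Finset.dvd_sum fun s hs => ?_
  rw [X_dvd_monomial]
  right
  intro h0
  have h1 := congrArg (coeff s) h
  rw [coeff_killVar, if_pos h0, coeff_zero] at h1
  exact mem_support_iff.1 hs h1

theorem killVar_mem_shiftedComponent {τ : Type*} {w : σ → (τ →₀ ℕ)} {n m : τ →₀ ℕ} (i : σ)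
    {f : MvPolynomial σ K} (hf : f ∈ shiftedComponent K w n m) :
    killVar K i f ∈ shiftedComponent K w n m := by
  intro s hs
  rw [coeff_killVar] at hs
  exact hf s fun h => hs (by rw [h, ite_self])

end KillVar

section Finite

theorem weight_apply_eq_degree {σ τ : Type*} {w : σ → (τ →₀ ℕ)} {t : τ} (hw : ∀ i, w i t = 1)
    (s : σ →₀ ℕ) : Finsupp.weight w s t = s.degree := by
  induction s using Finsupp.induction_linear with
  | zero => simp
  | add s u hs hu => simp [hs, hu]
  | single i n => simp [Finsupp.weight_single, hw]

/-- The coordinate t of the weight is the total degree, so only finitely many monomials occur. -/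
theorem finite_shiftedComponent {K σ τ : Type*} [Field K] [Finite σ] {w : σ → (τ →₀ ℕ)} {t : τ}
    (hw : ∀ i, w i t = 1) (n m : τ →₀ ℕ) : Module.Finite K (shiftedComponent K w n m) := by
  have hfin := Finsupp.finite_of_degree_le (σ := σ) (m t)
  have : FiniteDimensional K (Submodule.span K
      ((fun s => monomial s (1 : K)) '' {s : σ →₀ ℕ | s.degree ≤ m t})) :=
    FiniteDimensional.span_of_finite K (hfin.image _)
  refine Submodule.finiteDimensional_of_le (fun f hf => ?_) (S₂ := Submodule.span K
      ((fun s => monomial s (1 : K)) '' {s : σ →₀ ℕ | s.degree ≤ m t}))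
  rw [f.as_sum]
  refine Submodule.sum_mem _ fun s hs => ?_
  have h1 : monomial s (coeff s f) = coeff s f • monomial s (1 : K) := by simp [smul_monomial]
  rw [h1]
  refine Submodule.smul_mem _ _ (Submodule.subset_span ⟨s, ?_, rfl⟩)
  have h2 := congrArg (fun a : τ →₀ ℕ => a t) (hf s (mem_support_iff.1 hs))
  simp only [Finsupp.add_apply, weight_apply_eq_degree hw] at h2
  exact h2 ▸ Nat.le_add_right _ _

theorem finite_foxComponent {K X τ : Type*} [Field K] [Finite X] {w : X → (τ →₀ ℕ)} {t : τ}
    (hw : ∀ i, w i t = 1) (m : τ →₀ ℕ) : Module.Finite K (foxComponent K w m) := by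
  have hw' : ∀ i, (Sum.elim w w : X ⊕ X → (τ →₀ ℕ)) i t = 1 := by rintro (i | i) <;> simp [hw]
  have (j : X) : Module.Finite K (shiftedComponent K (Sum.elim w w) (w j) m) :=
    finite_shiftedComponent hw' _ _
  let F : foxComponent K w m →ₗ[K] ∀ j, shiftedComponent K (Sum.elim w w) (w j) m :=
    LinearMap.pi fun j => (LinearMap.proj j).restrict fun _ hz => mem_foxComponent.1 hz j
  refine Module.Finite.of_injective F fun y z h => Subtype.ext (funext fun j => ?_)
  exact congrArg Subtype.val (congrFun h j)

theorem finrank_eq_add_of_exact {K V W : Type*} [Field K] [AddCommGroup V] [Module K V]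
    [AddCommGroup W] [Module K W] {p q : Submodule K V} {r : Submodule K W} [Module.Finite K q]
    (f : V →ₗ[K] V) (g : V →ₗ[K] W) (hf : Function.Injective f) (hpq : ∀ v ∈ p, f v ∈ q)
    (hqr : ∀ v ∈ q, g v ∈ r) (hg : ∀ u ∈ r, ∃ v ∈ q, g v = u) (hfg : ∀ v ∈ p, g (f v) = 0)
    (hgf : ∀ v ∈ q, g v = 0 → ∃ u ∈ p, f u = v) :
    Module.finrank K q = Module.finrank K p + Module.finrank K r := by
  have hker : LinearMap.ker (g.restrict hqr) = LinearMap.range (f.restrict hpq) := by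
    ext ⟨v, hv⟩
    rw [LinearMap.mem_ker, LinearMap.mem_range]
    constructor
    · intro h
      obtain ⟨u, hu, rfl⟩ := hgf v hv (congrArg Subtype.val h)
      exact ⟨⟨u, hu⟩, rfl⟩
    · rintro ⟨⟨u, hu⟩, h⟩
      obtain rfl : f u = v := congrArg Subtype.val h
      exact Subtype.ext (hfg u hu)
  have hrange : LinearMap.range (g.restrict hqr) = ⊤ := by
    rw [eq_top_iff]
    rintro ⟨u, hu⟩ -
    obtain ⟨v, hv, rfl⟩ := hg u hu
    exact ⟨⟨v, hv⟩, rfl⟩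
  have hinj : Function.Injective (f.restrict hpq) := fun u v h =>
    Subtype.ext (hf (congrArg Subtype.val h))
  rw [← LinearMap.finrank_range_add_finrank_ker (g.restrict hqr), hker, hrange, finrank_top,
    LinearMap.finrank_range_of_inj hinj, add_comm]

/-- Multiplication of all components by a polynomial. -/
def mulComponents {K σ J : Type*} [Field K] (p : MvPolynomial σ K) :
    (J → MvPolynomial σ K) →ₗ[K] (J → MvPolynomial σ K) :=
  LinearMap.pi fun j => LinearMap.mulLeft K p ∘ₗ LinearMap.proj j

theorem mulComponents_apply {K σ J : Type*} [Field K] (p : MvPolynomial σ K)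
    (z : J → MvPolynomial σ K) : mulComponents p z = p • z := rfl

theorem mulComponents_X_injective {K σ J : Type*} [Field K] (i : σ) :
    Function.Injective (mulComponents (K := K) (J := J) (MvPolynomial.X i)) := by
  intro y z h
  rw [mulComponents_apply, mulComponents_apply] at h
  exact smul_right_injective _ (X_ne_zero i) h

end Finite

section Shift

variable {K : Type*} [Field K] {X : Type*} [Fintype X]

/-- The tensors `z` such that `y z` is a `δ`-constant in the kernel of `K[U, V] ⊗ K X → K[U, V]` of
multidegree `m`, for a variable `y` of multidegree `n` killed by `δ`. -/
def foxConstantsShift {τ : Type*} (α : Matrix X X K) (w : X → (τ →₀ ℕ)) (n m : τ →₀ ℕ) :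
    Submodule K (X → MvPolynomial (X ⊕ X) K) :=
  LinearMap.ker (foxSum K X) ⊓ LinearMap.ker (foxDer α) ⊓
    Submodule.pi Set.univ fun j => shiftedComponent K (Sum.elim w w) (w j + n) m

variable {τ : Type*} {α : Matrix X X K} {w : X → (τ →₀ ℕ)} {n m : τ →₀ ℕ}

theorem mem_foxConstantsShift {z : X → MvPolynomial (X ⊕ X) K} :
    z ∈ foxConstantsShift α w n m ↔ foxSum K X z = 0 ∧ foxDer α z = 0 ∧
      ∀ j, z j ∈ shiftedComponent K (Sum.elim w w) (w j + n) m := by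
  simp [foxConstantsShift, and_assoc, Submodule.mem_pi]

theorem foxConstantsShift_add :
    foxConstantsShift α w n (m + n) = foxConstants α w m := by
  ext z
  simp only [mem_foxConstantsShift, mem_foxConstants, mem_foxComponent, shiftedComponent_add]

theorem shiftedComponent_eq_bot {σ : Type*} {w : σ → (τ →₀ ℕ)} (h : ¬ n ≤ m) :
    shiftedComponent K w n m = ⊥ := by
  rw [eq_bot_iff]
  intro f hf
  rw [Submodule.mem_bot]
  ext s
  by_contra hs
  exact h (hf s hs ▸ le_add_self)

theorem foxConstantsShift_eq_bot (h : ¬ n ≤ m) : foxConstantsShift α w n m = ⊥ := by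
  rw [eq_bot_iff]
  intro z hz
  funext j
  have h1 := (mem_foxConstantsShift.1 hz).2.2 j
  rwa [shiftedComponent_eq_bot fun h' => h (le_add_self.trans h')] at h1

/-- Multiplication by a constant variable commutes with `foxSum` and `foxDer`, and a variable is not
a zero divisor. -/
theorem smul_mem_foxConstants_iff (i : X ⊕ X) (hi : polyDer α (MvPolynomial.X i) = 0)
    (z : X → MvPolynomial (X ⊕ X) K) :
    (MvPolynomial.X i : MvPolynomial (X ⊕ X) K) • z ∈ foxConstants α w m ↔
      z ∈ foxConstantsShift α w (Sum.elim w w i) m := by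
  have hX : (MvPolynomial.X i : MvPolynomial (X ⊕ X) K) ≠ 0 := X_ne_zero i
  have h1 : foxSum K X ((MvPolynomial.X i : MvPolynomial (X ⊕ X) K) • z) =
      MvPolynomial.X i * foxSum K X z := by
    simp only [foxSum_apply, Pi.smul_apply, smul_eq_mul, Finset.mul_sum, mul_left_comm]
  have h2 : foxDer α ((MvPolynomial.X i : MvPolynomial (X ⊕ X) K) • z) =
      (MvPolynomial.X i : MvPolynomial (X ⊕ X) K) • foxDer α z := by
    funext j
    simp [foxDer_apply, Derivation.leibniz, hi, mul_add, Finset.mul_sum]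
  rw [mem_foxConstants, mem_foxConstantsShift, h1, h2, mul_eq_zero, or_iff_right hX,
    smul_eq_zero, or_iff_right hX, mem_foxComponent]
  simp only [Pi.smul_apply, smul_eq_mul, X_mul_mem_shiftedComponent_iff, add_comm]

end Shift

section VarFree

variable {K : Type*} [Field K] {X : Type*} [DecidableEq X]

variable (K) in
/-- The tensors which do not depend on a variable. -/
def varFree (i : X ⊕ X) : Submodule K (X → MvPolynomial (X ⊕ X) K) where
  carrier := {z | ∀ j, killVar K i (z j) = z j}
  zero_mem' := by simp
  add_mem' := by intro y z hy hz j; simp [hy j, hz j]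
  smul_mem' := by intro c z hz j; simp [hz j]

theorem mem_varFree {i : X ⊕ X} {z : X → MvPolynomial (X ⊕ X) K} :
    z ∈ varFree K i ↔ ∀ j, killVar K i (z j) = z j := Iff.rfl

theorem exists_eq_smul_of_killVar_eq_zero {i : X ⊕ X} {z : X → MvPolynomial (X ⊕ X) K}
    (h : ∀ j, killVar K i (z j) = 0) :
    ∃ y : X → MvPolynomial (X ⊕ X) K, z = (MvPolynomial.X i : MvPolynomial (X ⊕ X) K) • y := by
  choose y hy using fun j => X_dvd_of_killVar_eq_zero (h j)
  exact ⟨y, funext hy⟩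

theorem smul_mem_varFree_iff {i j : X ⊕ X} (hij : j ≠ i) {z : X → MvPolynomial (X ⊕ X) K} :
    (MvPolynomial.X j : MvPolynomial (X ⊕ X) K) • z ∈ varFree K i ↔ z ∈ varFree K i := by
  simp only [mem_varFree, Pi.smul_apply, smul_eq_mul, map_mul, killVar_X_of_ne hij]
  exact forall_congr' fun k => mul_right_inj' (X_ne_zero j)

end VarFree

section Var

variable {K : Type*} [Field K] {X : Type*} [Fintype X]

theorem polyDer_X_eq_zero {α : Matrix X X K} {o : X} (h1 : ∀ i, α i o = 0) (i : X ⊕ X)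
    (hi : i = Sum.inl o ∨ i = Sum.inr o) : polyDer α (MvPolynomial.X i) = 0 := by
  rcases hi with rfl | rfl <;> simp [polyDer_X_inl, polyDer_X_inr, h1]

variable [DecidableEq X]

/-- The vanishing column says that δ kills u_o, the vanishing row that u_o occurs in no δ(u_j); so
u_o splits off as a direct summand for δ. -/
theorem killVar_polyDer {α : Matrix X X K} {o : X} (h1 : ∀ i, α i o = 0) (h2 : ∀ j, α o j = 0)
    (f : MvPolynomial (X ⊕ X) K) :
    killVar K (Sum.inl o) (polyDer α f) = polyDer α (killVar K (Sum.inl o) f) := by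
  apply algHom_derivation_comm
  rintro (j | j)
  · rcases eq_or_ne j o with rfl | hj
    · simp [killVar_X_self, polyDer_X_inl, h1]
    · rw [killVar_X_of_ne (by simpa using hj), polyDer_X_inl, map_sum]
      refine Finset.sum_congr rfl fun i _ => ?_
      rw [map_smul]
      rcases eq_or_ne i o with rfl | hi
      · simp [h2]
      · rw [killVar_X_of_ne (by simpa using hi)]
  · rw [killVar_X_of_ne (by simp), polyDer_X_inr, map_sum]
    refine Finset.sum_congr rfl fun i _ => ?_
    rw [map_smul, killVar_X_of_ne (by simp)]

variable {τ : Type*} {α : Matrix X X K} {w : X → (τ →₀ ℕ)} {o : X}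

theorem killVar_mem_foxConstants (h1 : ∀ i, α i o = 0) (h2 : ∀ j, α o j = 0) {m : τ →₀ ℕ}
    {z : X → MvPolynomial (X ⊕ X) K} (hz : z ∈ foxConstants α w m) :
    (fun j => killVar K (Sum.inl o) (z j)) ∈ foxConstants α w m := by
  obtain ⟨hs, hd, hc⟩ := mem_foxConstants.1 hz
  rw [mem_foxComponent] at hc
  refine mem_foxConstants.2 ⟨?_, ?_, ?_⟩
  · have := congrArg (killVar K (Sum.inl o)) hs
    rw [foxSum_apply, map_sum, map_zero] at this
    rw [← this, foxSum_apply]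
    refine Finset.sum_congr rfl fun j _ => ?_
    rw [map_mul, killVar_X_of_ne (by simp)]
  · funext j
    have := congrArg (killVar K (Sum.inl o)) (congrFun hd j)
    rw [foxDer_apply, map_add, map_sum, killVar_polyDer h1 h2] at this
    rw [foxDer_apply]
    simpa using this
  · exact mem_foxComponent.2 fun j => killVar_mem_shiftedComponent _ (hc j)

/-- The substitution u_o ↦ 0 is a projection of the constants onto those free of u_o. Its kernel
consists of the u_o-multiples, and the cofactor is again a constant of the kernel. -/
theorem finrank_foxConstants_eq_add (h1 : ∀ i, α i o = 0) (h2 : ∀ j, α o j = 0) {t : τ}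
    (hw : ∀ i, w i t = 1) (m : τ →₀ ℕ) :
    Module.finrank K (foxConstants α w m) =
      Module.finrank K (foxConstantsShift α w (w o) m) +
        Module.finrank K ↥(foxConstants α w m ⊓ varFree K (Sum.inl o)) := by
  have := finite_foxComponent (K := K) hw m
  have : Module.Finite K (foxConstants α w m) :=
    Submodule.finiteDimensional_of_le (S₂ := foxComponent K w m) inf_le_right
  have hi := polyDer_X_eq_zero h1 (Sum.inl o) (Or.inl rfl)
  let G : (X → MvPolynomial (X ⊕ X) K) →ₗ[K] (X → MvPolynomial (X ⊕ X) K) :=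
    LinearMap.pi fun j => (killVar K (Sum.inl o)).toLinearMap ∘ₗ LinearMap.proj j
  have hG : ∀ z j, G z j = killVar K (Sum.inl o) (z j) := fun _ _ => rfl
  have hidem : ∀ f, killVar K (Sum.inl o) (killVar K (Sum.inl o) f) =
      killVar K (Sum.inl o : X ⊕ X) f := by
    intro f
    ext s
    simp only [coeff_killVar]
    split_ifs <;> rfl
  refine finrank_eq_add_of_exact (mulComponents (MvPolynomial.X (Sum.inl o))) G
    (mulComponents_X_injective _) (fun z hz => (smul_mem_foxConstants_iff (Sum.inl o) hi z).2 hz)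
    (fun z hz => ⟨killVar_mem_foxConstants h1 h2 hz, fun j => hidem (z j)⟩)
    (fun z hz => ⟨z, hz.1, funext hz.2⟩) (fun z hz => ?_) fun z hz h => ?_
  · funext j
    rw [hG, mulComponents_apply, Pi.smul_apply, smul_eq_mul, map_mul, killVar_X_self, zero_mul]
    rfl
  · obtain ⟨y, rfl⟩ := exists_eq_smul_of_killVar_eq_zero (i := Sum.inl o) (z := z)
      fun j => congrFun h j
    exact ⟨y, (smul_mem_foxConstants_iff (Sum.inl o) hi y).1 hz, rfl⟩

end Var

end FreeMetabelian

end
-- Passing to the variables Y, and constants under the Euler derivation.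
noncomputable section

namespace FreeMetabelian

open MvPolynomial

section Embedding

variable {K : Type*} [Field K] {X Y : Type*} (e : Option Y ≃ X)

/-- The embedding of `K[U, V]` for the variables `Y` into the one for `Y` and one more variable. -/
def embY (K : Type*) [Field K] {X Y : Type*} (e : Option Y ≃ X) :
    MvPolynomial (Y ⊕ Y) K →ₐ[K] MvPolynomial (X ⊕ X) K :=
  rename (Sum.map (fun y => e (some y)) (fun y => e (some y)))

/-- The substitution of `0` for both of the variables of `K[U, V]` which do not come from `Y`. -/
def resY (K : Type*) [Field K] {X Y : Type*} (e : Option Y ≃ X) :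
    MvPolynomial (X ⊕ X) K →ₐ[K] MvPolynomial (Y ⊕ Y) K :=
  aeval (Sum.elim (fun x => (e.symm x).elim 0 fun y => MvPolynomial.X (Sum.inl y))
    (fun x => (e.symm x).elim 0 fun y => MvPolynomial.X (Sum.inr y)))

theorem embY_X_inl (y : Y) :
    embY K e (MvPolynomial.X (Sum.inl y)) = MvPolynomial.X (Sum.inl (e (some y))) := by
  simp [embY]

theorem embY_X_inr (y : Y) :
    embY K e (MvPolynomial.X (Sum.inr y)) = MvPolynomial.X (Sum.inr (e (some y))) := by
  simp [embY]

theorem resY_X_inl_some (y : Y) :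
    resY K e (MvPolynomial.X (Sum.inl (e (some y)))) = MvPolynomial.X (Sum.inl y) := by
  simp [resY]

theorem resY_X_inr_some (y : Y) :
    resY K e (MvPolynomial.X (Sum.inr (e (some y)))) = MvPolynomial.X (Sum.inr y) := by
  simp [resY]

theorem resY_X_inl_none : resY K e (MvPolynomial.X (Sum.inl (e none))) = 0 := by
  simp [resY]

theorem resY_X_inr_none : resY K e (MvPolynomial.X (Sum.inr (e none))) = 0 := by
  simp [resY]

theorem equivOption_cases {P : X → Prop} (h0 : P (e none)) (h1 : ∀ y, P (e (some y))) (x : X) :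
    P x := by
  obtain ⟨y, rfl⟩ := e.surjective x
  cases y with
  | none => exact h0
  | some y => exact h1 y

theorem resY_embY (f : MvPolynomial (Y ⊕ Y) K) : resY K e (embY K e f) = f := by
  have : (resY K e).comp (embY K e) = AlgHom.id K _ := by
    apply MvPolynomial.algHom_ext
    rintro (y | y) <;>
      simp [embY_X_inl, embY_X_inr, resY_X_inl_some, resY_X_inr_some]
  exact DFunLike.congr_fun this f

theorem embY_resY [DecidableEq X] (f : MvPolynomial (X ⊕ X) K) : embY K e (resY K e f) =
    killVar K (Sum.inr (e none)) (killVar K (Sum.inl (e none)) f) := by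
  have : (embY K e).comp (resY K e) =
      (killVar K (Sum.inr (e none))).comp (killVar K (Sum.inl (e none))) := by
    apply MvPolynomial.algHom_ext
    rintro (x | x) <;> revert x <;> refine equivOption_cases e ?_ fun y => ?_
    · simp [resY_X_inl_none, killVar_X_self]
    · simp [resY_X_inl_some, embY_X_inl, killVar_X_of_ne]
    · simp [resY_X_inr_none, killVar_X_self, killVar_X_of_ne]
    · simp [resY_X_inr_some, embY_X_inr, killVar_X_of_ne]
  exact DFunLike.congr_fun this f

theorem killVar_embY [DecidableEq X] (f : MvPolynomial (Y ⊕ Y) K) :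
    killVar K (Sum.inl (e none)) (embY K e f) = embY K e f := by
  have : (killVar K (Sum.inl (e none))).comp (embY K e) = embY K e := by
    apply MvPolynomial.algHom_ext
    rintro (y | y)
    · simp [embY_X_inl, killVar_X_of_ne]
    · simp [embY_X_inr, killVar_X_of_ne]
  exact DFunLike.congr_fun this f

theorem embY_mem_shiftedComponent_iff {τ : Type*} (w : X → (τ →₀ ℕ)) {n m : τ →₀ ℕ}
    (f : MvPolynomial (Y ⊕ Y) K) :
    embY K e f ∈ shiftedComponent K (Sum.elim w w) n m ↔
      f ∈ shiftedComponent K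
        (Sum.elim (fun y => w (e (some y))) (fun y => w (e (some y)))) n m := by
  set φ : Y ⊕ Y → X ⊕ X := Sum.map (fun y => e (some y)) (fun y => e (some y))
  have hinj : Function.Injective φ :=
    Sum.map_injective.2 ⟨e.injective.comp (Option.some_injective Y),
      e.injective.comp (Option.some_injective Y)⟩
  have hw : ∀ u : Y ⊕ Y →₀ ℕ, Finsupp.weight (Sum.elim w w) (u.mapDomain φ) =
      Finsupp.weight (Sum.elim (fun y => w (e (some y))) (fun y => w (e (some y)))) u := by
    intro u
    induction u using Finsupp.induction_linear with
    | zero => simp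
    | add s t hs ht => rw [Finsupp.mapDomain_add, map_add, map_add, hs, ht]
    | single i n => rcases i with i | i <;> simp [Finsupp.weight_single, φ]
  constructor
  · intro h s hs
    rw [← hw]
    apply h
    rwa [embY, coeff_rename_mapDomain _ hinj]
  · intro h s hs
    obtain ⟨u, rfl, hu⟩ := coeff_rename_ne_zero _ _ _ hs
    rw [hw]
    exact h u hu

theorem resY_mem_shiftedComponent {τ : Type*} (w : X → (τ →₀ ℕ)) {n m : τ →₀ ℕ}
    {f : MvPolynomial (X ⊕ X) K} (hf : f ∈ shiftedComponent K (Sum.elim w w) n m) :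
    resY K e f ∈ shiftedComponent K
        (Sum.elim (fun y => w (e (some y))) (fun y => w (e (some y)))) n m := by
  classical
  rw [← embY_mem_shiftedComponent_iff, embY_resY]
  exact killVar_mem_shiftedComponent _ (killVar_mem_shiftedComponent _ hf)

variable [Fintype X] [Fintype Y]

theorem sum_option_equiv {M : Type*} [AddCommMonoid M] (F : X → M) :
    ∑ x, F x = F (e none) + ∑ y, F (e (some y)) := by
  rw [← e.sum_comp, Fintype.sum_option]

variable {α : Matrix X X K}

theorem embY_polyDer (h2 : ∀ j, α (e none) j = 0) (f : MvPolynomial (Y ⊕ Y) K) :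
    embY K e (polyDer (α.submatrix (fun y => e (some y)) (fun y => e (some y))) f) =
      polyDer α (embY K e f) := by
  apply algHom_derivation_comm
  rintro (y | y)
  · rw [embY_X_inl, polyDer_X_inl, polyDer_X_inl, sum_option_equiv e, h2]
    simp [embY_X_inl]
  · rw [embY_X_inr, polyDer_X_inr, polyDer_X_inr, sum_option_equiv e, h2]
    simp [embY_X_inr]

theorem resY_polyDer (h1 : ∀ i, α i (e none) = 0) (h2 : ∀ j, α (e none) j = 0)
    (f : MvPolynomial (X ⊕ X) K) :
    resY K e (polyDer α f) =
      polyDer (α.submatrix (fun y => e (some y)) (fun y => e (some y))) (resY K e f) := by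
  apply algHom_derivation_comm
  rintro (x | x) <;> revert x <;> refine equivOption_cases e ?_ fun y => ?_
  · rw [resY_X_inl_none, polyDer_X_inl]; simp [h1]
  · rw [resY_X_inl_some, polyDer_X_inl, polyDer_X_inl, sum_option_equiv e, h2]
    simp [resY_X_inl_some]
  · rw [resY_X_inr_none, polyDer_X_inr]; simp [h1]
  · rw [resY_X_inr_some, polyDer_X_inr, polyDer_X_inr, sum_option_equiv e, h2]
    simp [resY_X_inr_some]

theorem resY_mem_omegaIdeal {z : X → MvPolynomial (X ⊕ X) K} (hz : foxSum K X z = 0) :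
    resY K e (z (e none)) ∈ omegaIdeal K Y := by
  classical
  -- Setting v_y = 0 for all y except o reduces ∑ v_j z_j = 0 to v_o θ(z_o) = 0, so θ(z_o) = 0.
  let θ : MvPolynomial (X ⊕ X) K →ₐ[K] MvPolynomial (X ⊕ X) K :=
    aeval (Sum.elim (fun x => MvPolynomial.X (Sum.inl x))
      (fun x => if x = e none then MvPolynomial.X (Sum.inr x) else 0))
  have h1 : θ (z (e none)) = 0 := by
    have := congrArg θ hz
    rw [foxSum_apply, sum_option_equiv e, map_add, map_sum, map_zero] at this
    simpa [θ, X_ne_zero] using this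
  have h2 : (killV K Y).comp (resY K e) = (resY K e).comp θ := by
    apply MvPolynomial.algHom_ext
    rintro (x | x) <;> revert x <;> refine equivOption_cases e ?_ fun y => ?_
    · simp [resY_X_inl_none, θ]
    · simp [resY_X_inl_some, θ, killV]
    · simp [resY_X_inr_none, θ]
    · simp [resY_X_inr_some, θ, killV]
  have h3 := DFunLike.congr_fun h2 (z (e none))
  rw [AlgHom.comp_apply, AlgHom.comp_apply, h1, map_zero] at h3
  exact (mem_omegaIdeal_iff _).2 h3

end Embedding

section Lift

variable {K : Type*} [Field K] [CharZero K] {Y : Type*} [Fintype Y]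

/-- The Poincaré lemma for constants: a constant of `K[U, V]_ω` is the image of a constant under
the Euler derivation. -/
theorem exists_eulerV_eq {τ : Type*} {w : Y ⊕ Y → (τ →₀ ℕ)} {n m : τ →₀ ℕ} {α : Matrix Y Y K}
    {g : MvPolynomial (Y ⊕ Y) K} (hg : g ∈ omegaConstants α) (hm : g ∈ shiftedComponent K w n m) :
    ∃ f, eulerV K Y f = g ∧ polyDer α f = 0 ∧ f ∈ shiftedComponent K w n m := by
  obtain ⟨hω, hδ⟩ := hg
  have hω' := (killV_eq_zero_iff _).1 ((mem_omegaIdeal_iff _).1 hω)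
  obtain ⟨f, hf, hs⟩ := exists_eulerV_add_smul_eq 0 g (by simpa using hω')
  rw [Nat.cast_zero, zero_smul, add_zero] at hf
  have hfω : killV K Y f = 0 := (killV_eq_zero_iff _).2 fun s h => hω' s (hs s h)
  refine ⟨f, hf, ?_, fun s h => hm s (hs s h)⟩
  -- δ f lies in K[U, V]_ω, where E is injective, and E(δ f) = δ(E f) = δ g = 0.
  refine eulerV_add_smul_injective 0 _ ?_ ?_
  · simpa using (killV_eq_zero_iff _).1 (by rw [killV_polyDer, hfω, map_zero])
  · rw [Nat.cast_zero, zero_smul, add_zero, eulerV_polyDer, hf]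
    exact hδ

end Lift

end FreeMetabelian

end
-- Splitting off the variable v_o.
noncomputable section

namespace FreeMetabelian

open MvPolynomial

theorem finrank_submodule_prod {K V W : Type*} [Field K] [AddCommGroup V] [Module K V]
    [AddCommGroup W] [Module K W] (p : Submodule K V) (q : Submodule K W) [Module.Finite K p]
    [Module.Finite K q] :
    Module.finrank K (p.prod q) = Module.finrank K p + Module.finrank K q := by
  rw [← Module.finrank_prod]
  exact LinearEquiv.finrank_eq
    { toFun := fun v => (⟨v.1.1, v.2.1⟩, ⟨v.1.2, v.2.2⟩)
      invFun := fun v => ⟨(v.1, v.2), v.1.2, v.2.2⟩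
      map_add' := fun _ _ => rfl
      map_smul' := fun _ _ => rfl
      left_inv := fun _ => rfl
      right_inv := fun _ => rfl }

section Recursion

variable {K : Type*} [Field K] {X Y τ : Type*} [Fintype X] [Fintype Y]
variable (e : Option Y ≃ X) {α : Matrix X X K} {w : X → (τ →₀ ℕ)}

theorem resY_mem_prod (h1 : ∀ i, α i (e none) = 0) (h2 : ∀ j, α (e none) j = 0) {m : τ →₀ ℕ}
    {z : X → MvPolynomial (X ⊕ X) K} (hz : z ∈ foxConstants α w m) :
    (fun y => resY K e (z (e (some y)))) ∈
        foxConstants (α.submatrix (fun y => e (some y)) (fun y => e (some y)))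
          (fun y => w (e (some y))) m ∧
      resY K e (z (e none)) ∈
        omegaConstants (α.submatrix (fun y => e (some y)) (fun y => e (some y))) ⊓
          shiftedComponent K (Sum.elim (fun y => w (e (some y))) (fun y => w (e (some y))))
            (w (e none)) m := by
  obtain ⟨hs, hd, hc⟩ := mem_foxConstants.1 hz
  rw [mem_foxComponent] at hc
  refine ⟨mem_foxConstants.2 ⟨?_, ?_, ?_⟩, ⟨resY_mem_omegaIdeal e hs, ?_⟩, ?_⟩
  · have := congrArg (resY K e) hs
    rw [foxSum_apply, sum_option_equiv e, map_add, map_sum, map_mul, resY_X_inr_none, zero_mul,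
      zero_add, map_zero] at this
    rw [foxSum_apply, ← this]
    exact Finset.sum_congr rfl fun y _ => by rw [map_mul, resY_X_inr_some]
  · funext y
    have := congrArg (resY K e) (congrFun hd (e (some y)))
    rw [foxDer_apply, map_add, map_sum, resY_polyDer e h1 h2, sum_option_equiv e, h1] at this
    rw [foxDer_apply]
    simpa using this
  · exact mem_foxComponent.2 fun y => resY_mem_shiftedComponent e w (hc _)
  · have := congrArg (resY K e) (congrFun hd (e none))
    rw [foxDer_apply, map_add, resY_polyDer e h1 h2] at this
    simpa [h2] using this
  · exact resY_mem_shiftedComponent e w (hc _)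

variable [CharZero K] [DecidableEq X]

/-- With E b = g, the coordinates g at o and f_y - v_o ∂b/∂v_y at y satisfy the kernel equation, as
∑ v_y f_y = 0 and v_o g - v_o E b = 0. The correction terms disappear at v_o = 0. Choosing b
constant makes the whole tuple constant, by `pderiv_polyDer`. -/
theorem exists_resY_eq (h1 : ∀ i, α i (e none) = 0) (h2 : ∀ j, α (e none) j = 0) {m : τ →₀ ℕ}
    {f : Y → MvPolynomial (Y ⊕ Y) K} {g : MvPolynomial (Y ⊕ Y) K}
    (hf : f ∈ foxConstants (α.submatrix (fun y => e (some y)) (fun y => e (some y)))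
          (fun y => w (e (some y))) m)
    (hg : g ∈ omegaConstants (α.submatrix (fun y => e (some y)) (fun y => e (some y))) ⊓
          shiftedComponent K (Sum.elim (fun y => w (e (some y))) (fun y => w (e (some y))))
            (w (e none)) m) :
    ∃ z ∈ foxConstants α w m ⊓ varFree K (Sum.inl (e none)),
      (fun y => resY K e (z (e (some y)))) = f ∧ resY K e (z (e none)) = g := by
  obtain ⟨hs, hd, hc⟩ := mem_foxConstants.1 hf
  rw [mem_foxComponent] at hc
  obtain ⟨b, hb, hδ, hm⟩ := exists_eulerV_eq hg.1 hg.2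
  let z : X → MvPolynomial (X ⊕ X) K := fun x => (e.symm x).elim (embY K e g) fun y =>
    embY K e (f y) - MvPolynomial.X (Sum.inr (e none)) * embY K e (pderiv (Sum.inr y) b)
  have hz0 : z (e none) = embY K e g := by simp [z]
  have hz1 : ∀ y, z (e (some y)) = embY K e (f y) -
      MvPolynomial.X (Sum.inr (e none)) * embY K e (pderiv (Sum.inr y) b) := by
    intro y; simp [z]
  have ho : polyDer α (MvPolynomial.X (Sum.inr (e none))) = 0 :=
    polyDer_X_eq_zero h1 _ (Or.inr rfl)
  refine ⟨z, ⟨mem_foxConstants.2 ⟨?_, ?_, ?_⟩, ?_⟩, ?_, ?_⟩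
  · have hs' := congrArg (embY K e) hs
    rw [foxSum_apply, map_sum, map_zero] at hs'
    have hb' := congrArg (embY K e) hb
    rw [eulerV_eq_sum, map_sum] at hb'
    simp only [map_mul, embY_X_inr] at hs' hb'
    rw [foxSum_apply, sum_option_equiv e, hz0]
    simp only [hz1, mul_sub, Finset.sum_sub_distrib, hs']
    rw [← hb', Finset.mul_sum]
    simp only [mul_left_comm]
    ring
  · funext x
    revert x
    refine equivOption_cases e ?_ fun y => ?_
    · have hg0 : polyDer (α.submatrix (fun y => e (some y)) (fun y => e (some y))) g = 0 := hg.1.2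
      rw [foxDer_apply, hz0, ← embY_polyDer e h2, hg0]
      simp [h2]
    · have hf' := congrArg (embY K e) (congrFun hd y)
      have hp := congrArg (embY K e) (pderiv_polyDer
        (α.submatrix (fun y => e (some y)) (fun y => e (some y))) y b)
      rw [hδ, map_zero, map_zero, map_add, map_sum, embY_polyDer e h2] at hp
      rw [foxDer_apply, map_add, map_sum, embY_polyDer e h2, Pi.zero_apply, map_zero] at hf'
      simp only [map_smul, Matrix.submatrix_apply] at hp hf'
      rw [foxDer_apply, sum_option_equiv e, h1, zero_smul, zero_add, hz1, map_sub,
        Derivation.leibniz, ho, smul_zero, add_zero, smul_eq_mul]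
      simp only [hz1, smul_sub, Finset.sum_sub_distrib, ← mul_smul_comm, ← Finset.mul_sum]
      rw [Pi.zero_apply]
      linear_combination hf' + MvPolynomial.X (Sum.inr (e none)) * hp
  · rw [mem_foxComponent]
    refine equivOption_cases e ?_ fun y => ?_
    · rw [hz0, embY_mem_shiftedComponent_iff]
      exact hg.2
    · rw [hz1]
      refine sub_mem ((embY_mem_shiftedComponent_iff e w _).2 (hc y)) ?_
      rw [X_mul_mem_shiftedComponent_iff, embY_mem_shiftedComponent_iff, Sum.elim_inr, add_comm]
      exact pderiv_mem_shiftedComponent (Sum.inr y) hm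
  · refine mem_varFree.2 (equivOption_cases e ?_ fun y => ?_)
    · rw [hz0, killVar_embY]
    · rw [hz1, map_sub, map_mul, killVar_embY, killVar_embY, killVar_X_of_ne (by simp)]
  · funext y
    rw [hz1, map_sub, map_mul, resY_embY, resY_X_inr_none, zero_mul, sub_zero]
  · rw [hz0, resY_embY]

/-- The map sets u_o = v_o = 0 and separates the coordinate at o from the others. On tuples free of
u_o its kernel consists of the v_o-multiples; `exists_resY_eq` gives surjectivity. -/
theorem finrank_varFree_eq_add (h1 : ∀ i, α i (e none) = 0) (h2 : ∀ j, α (e none) j = 0) {t : τ}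
    (hw : ∀ i, w i t = 1) (m : τ →₀ ℕ) :
    Module.finrank K ↥(foxConstants α w m ⊓ varFree K (Sum.inl (e none))) =
      Module.finrank K ↥(foxConstantsShift α w (w (e none)) m ⊓ varFree K (Sum.inl (e none))) +
        (Module.finrank K (foxConstants (α.submatrix (fun y => e (some y)) (fun y => e (some y)))
            (fun y => w (e (some y))) m) +
          Module.finrank K ↥(omegaConstants
            (α.submatrix (fun y => e (some y)) (fun y => e (some y))) ⊓
            shiftedComponent K (Sum.elim (fun y => w (e (some y))) (fun y => w (e (some y))))
            (w (e none)) m)) := by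
  have hw' : ∀ i, (Sum.elim (fun y => w (e (some y))) (fun y => w (e (some y))) :
      Y ⊕ Y → (τ →₀ ℕ)) i t = 1 := by
    rintro (i | i) <;> simp [hw]
  have := finite_foxComponent (K := K) hw m
  have : Module.Finite K ↥(foxConstants α w m ⊓ varFree K (Sum.inl (e none))) :=
    Submodule.finiteDimensional_of_le (S₂ := foxComponent K w m)
      (inf_le_left.trans inf_le_right)
  have := finite_foxComponent (K := K) (w := fun y => w (e (some y))) (fun y => hw _) m
  have : Module.Finite K (foxConstants (α.submatrix (fun y => e (some y)) (fun y => e (some y)))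
            (fun y => w (e (some y))) m) :=
    Submodule.finiteDimensional_of_le (S₂ := foxComponent K _ m) inf_le_right
  have := finite_shiftedComponent (K := K) hw' (w (e none)) m
  have : Module.Finite K ↥(omegaConstants
            (α.submatrix (fun y => e (some y)) (fun y => e (some y))) ⊓
            shiftedComponent K (Sum.elim (fun y => w (e (some y))) (fun y => w (e (some y))))
            (w (e none)) m) :=
    Submodule.finiteDimensional_of_le inf_le_right
  rw [← finrank_submodule_prod]
  have hi := polyDer_X_eq_zero h1 (Sum.inr (e none)) (Or.inr rfl)
  let G : (X → MvPolynomial (X ⊕ X) K) →ₗ[K]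
      (Y → MvPolynomial (Y ⊕ Y) K) × MvPolynomial (Y ⊕ Y) K :=
    (LinearMap.pi fun y => (resY K e).toLinearMap ∘ₗ LinearMap.proj (e (some y))).prod
      ((resY K e).toLinearMap ∘ₗ LinearMap.proj (e none))
  have hG : ∀ z, G z = (fun y => resY K e (z (e (some y))), resY K e (z (e none))) :=
    fun _ => rfl
  refine finrank_eq_add_of_exact (mulComponents (MvPolynomial.X (Sum.inr (e none)))) G
    (mulComponents_X_injective _) (fun z hz => ?_) (fun z hz => ?_) (fun u hu => ?_)
    (fun z hz => ?_) (fun z hz h => ?_)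
  · rw [mulComponents_apply]
    exact ⟨(smul_mem_foxConstants_iff (Sum.inr (e none)) hi z).2 hz.1,
      (smul_mem_varFree_iff (by simp)).2 hz.2⟩
  · rw [hG]
    exact resY_mem_prod e h1 h2 hz.1
  · obtain ⟨z, hz, hz1, hz2⟩ := exists_resY_eq e h1 h2 hu.1 hu.2
    exact ⟨z, hz, by rw [hG, hz1, hz2]⟩
  · rw [hG, mulComponents_apply]
    ext : 1
    · funext y
      simp [resY_X_inr_none]
    · simp [resY_X_inr_none]
  · rw [hG, Prod.mk_eq_zero] at h
    have hres : ∀ x, resY K e (z x) = 0 :=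
      equivOption_cases e h.2 fun y => congrFun h.1 y
    obtain ⟨y, rfl⟩ := exists_eq_smul_of_killVar_eq_zero (i := Sum.inr (e none)) (z := z) fun x => by
      rw [← hz.2 x, ← embY_resY, hres, map_zero]
    exact ⟨y, ⟨(smul_mem_foxConstants_iff (Sum.inr (e none)) hi y).1 hz.1,
      (smul_mem_varFree_iff (by simp)).1 hz.2⟩, rfl⟩

end Recursion

/-! ### From dimensions to the recursion for Hilbert series. -/

section Series

theorem coeff_X_mul_eq {τ : Type*} (t : τ) (m : τ →₀ ℕ) (H : MvPowerSeries τ ℚ)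
    [Decidable (Finsupp.single t 1 ≤ m)] :
    MvPowerSeries.coeff m (MvPowerSeries.X t * H) =
      if Finsupp.single t 1 ≤ m then MvPowerSeries.coeff (m - Finsupp.single t 1) H else 0 := by
  classical
  rw [MvPowerSeries.X, MvPowerSeries.coeff_monomial_mul]
  simp

variable {K : Type*} [Field K] [CharZero K] {X Y τ : Type*} [Fintype X] [DecidableEq X] [Fintype Y]

/-- The recursion for the Hilbert series of the constants in the commutator ideal if one generator
`x_o`, of multidegree `t`, is a constant which splits off. -/
theorem one_sub_sq_mul_hilbertSeries (e : Option Y ≃ X) {α : Matrix X X K} {w : X → (τ →₀ ℕ)}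
    (h1 : ∀ i, α i (e none) = 0) (h2 : ∀ j, α (e none) j = 0) {t : τ} (hw : ∀ i, w i t = 1)
    (ho : w (e none) = Finsupp.single t 1) :
    (1 - MvPowerSeries.X t) ^ 2 * hilbertSeries (component K w) (commConstants α) =
      hilbertSeries (component K fun y => w (e (some y)))
          (commConstants (α.submatrix (fun y => e (some y)) (fun y => e (some y)))) +
        MvPowerSeries.X t * hilbertSeries (polyComponent K fun y => w (e (some y)))
          (omegaConstants (α.submatrix (fun y => e (some y)) (fun y => e (some y)))) := by
  classical
  set α' := α.submatrix (fun y => e (some y)) (fun y => e (some y))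
  set w' : Y → (τ →₀ ℕ) := fun y => w (e (some y))
  set H := hilbertSeries (component K w) (commConstants α)
  set A := hilbertSeries (component K w') (commConstants α')
  set B := hilbertSeries (polyComponent K w') (omegaConstants α')
  let H0 : MvPowerSeries τ ℚ := fun m =>
    (Module.finrank K ↥(foxConstants α w m ⊓ varFree K (Sum.inl (e none))) : ℚ)
  have hH : ∀ m, MvPowerSeries.coeff m H = (Module.finrank K (foxConstants α w m) : ℚ) := by
    intro m
    rw [← finrank_commConstants]
    rfl
  have hA : ∀ m, MvPowerSeries.coeff m A = (Module.finrank K (foxConstants α' w' m) : ℚ) := by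
    intro m
    rw [← finrank_commConstants]
    rfl
  have hB : ∀ m, MvPowerSeries.coeff m B = (Module.finrank K
      ↥(omegaConstants α' ⊓ polyComponent K w' m) : ℚ) := fun m => rfl
  have hH0 : ∀ m, MvPowerSeries.coeff m H0 = (Module.finrank K
      ↥(foxConstants α w m ⊓ varFree K (Sum.inl (e none))) : ℚ) := fun m => rfl
  -- Exact sequence for u_o. In degrees not divisible by the variable t the shifted space is zero,
  -- matching the zero coefficient of the product.
  have e1 : H = MvPowerSeries.X t * H + H0 := by
    ext m
    rw [map_add, coeff_X_mul_eq, hH0, hH, finrank_foxConstants_eq_add h1 h2 hw m, ho]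
    split_ifs with h
    · obtain ⟨k, rfl⟩ := exists_add_of_le h
      rw [add_tsub_cancel_left, hH, add_comm (Finsupp.single t 1) k, foxConstantsShift_add]
      push_cast; rfl
    · rw [foxConstantsShift_eq_bot h]
      simp
  -- Exact sequence for v_o. The factor before B is the degree of x_o itself, carried by the
  -- coordinate at o.
  have e2 : H0 = MvPowerSeries.X t * H0 + (A + MvPowerSeries.X t * B) := by
    ext m
    rw [map_add, map_add, coeff_X_mul_eq, coeff_X_mul_eq, hH0, hA,
      finrank_varFree_eq_add e h1 h2 hw m, ho]
    split_ifs with h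
    · obtain ⟨k, rfl⟩ := exists_add_of_le h
      rw [add_tsub_cancel_left, hH0, hB, add_comm (Finsupp.single t 1) k, foxConstantsShift_add,
        shiftedComponent_add_eq]
      push_cast; rfl
    · rw [foxConstantsShift_eq_bot h, shiftedComponent_eq_bot h]
      rw [bot_inf_eq, inf_bot_eq, finrank_bot, finrank_bot]
      push_cast
      ring
  have e3 : (1 - MvPowerSeries.X t) * H = H0 := by linear_combination e1
  have e4 : (1 - MvPowerSeries.X t) * H0 = A + MvPowerSeries.X t * B := by linear_combination e2
  rw [pow_two, mul_assoc, e3, e4]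

end Series

end FreeMetabelian

end
-- Specialization to the bigraded and the graded series.
noncomputable section

namespace FreeMetabelian

theorem eq_inv_sq_mul {τ : Type*} (t : τ) {H R : MvPowerSeries τ ℚ}
    (h : (1 - MvPowerSeries.X t) ^ 2 * H = R) : H = ((1 - MvPowerSeries.X t) ^ 2)⁻¹ * R := by
  rw [mul_comm, MvPowerSeries.eq_mul_inv_iff_mul_eq (by simp), mul_comm, h]

/-- The indices for a Jordan basis the last cell of which is `1 × 1`. -/
def jordanIndexEquiv {s : ℕ} (p : Fin (s + 1) → ℕ) (hp : p (Fin.last s) = 0) :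
    Option (JordanIndex fun i : Fin s => p i.castSucc) ≃ JordanIndex p :=
  Equiv.ofBijective
    (fun a => a.elim ⟨Fin.last s, 0⟩ fun b => ⟨b.1.castSucc, b.2⟩) <| by
      constructor
      · rintro (_ | ⟨i, k⟩) (_ | ⟨j, l⟩) h
        · rfl
        · exact absurd (congrArg Sigma.fst h).symm (Fin.castSucc_lt_last j).ne
        · exact absurd (congrArg Sigma.fst h) (Fin.castSucc_lt_last i).ne
        · obtain rfl : i = j := Fin.castSucc_injective s (congrArg Sigma.fst h)
          simpa using h
      · rintro ⟨i, k⟩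
        induction i using Fin.lastCases with
        | last =>
          refine ⟨none, ?_⟩
          have : k = 0 := Fin.ext (by have := k.2; simp only [Fin.val_zero]; omega)
          rw [this]
          rfl
        | cast i => exact ⟨some ⟨i, k⟩, rfl⟩

theorem jordanIndexEquiv_none {s : ℕ} (p : Fin (s + 1) → ℕ) (hp : p (Fin.last s) = 0) :
    jordanIndexEquiv p hp none = ⟨Fin.last s, 0⟩ := rfl

theorem jordanIndexEquiv_some {s : ℕ} (p : Fin (s + 1) → ℕ) (hp : p (Fin.last s) = 0)
    (b : JordanIndex fun i : Fin s => p i.castSucc) :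
    jordanIndexEquiv p hp (some b) = ⟨b.1.castSucc, b.2⟩ := rfl

theorem hilbertCommGL_eq (K : Type*) [Field K] [CharZero K] (s : ℕ) (p : Fin (s + 1) → ℕ)
    (hp : p (Fin.last s) = 0) : hilbertCommGL K p = ((1 - MvPowerSeries.X 2) ^ 2)⁻¹ *
      (hilbertCommGL K (fun i : Fin s => p i.castSucc) +
        MvPowerSeries.X 2 * hilbertOmegaGL K (fun i : Fin s => p i.castSucc)) := by
  have hsub : (jordanMatrix K p).submatrix (fun y => jordanIndexEquiv p hp (some y))
      (fun y => jordanIndexEquiv p hp (some y)) =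
      jordanMatrix K (fun i : Fin s => p i.castSucc) := by
    ext a b
    simp [jordanMatrix, jordanIndexEquiv_some]
  have h := one_sub_sq_mul_hilbertSeries (K := K) (jordanIndexEquiv p hp)
    (α := jordanMatrix K p) (w := jordanDegree p) (t := 2) ?_ ?_ ?_ ?_
  · rw [hsub] at h
    exact eq_inv_sq_mul 2 h
  · intro a
    simp [jordanIndexEquiv_none, jordanMatrix]
  · rintro ⟨i, k⟩
    rw [jordanIndexEquiv_none, jordanMatrix, if_neg]
    -- A nonzero entry in this row would need a vector of index 1 in the last cell, which has only
    -- the index 0.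
    rintro ⟨rfl, h⟩
    have := k.2
    simp only [Fin.val_zero] at h
    omega
  · intro a
    simp [jordanDegree]
  -- Since the last cell has p = 0, its vector has bidegree (0, 0), and its multidegree is that of z
  -- alone.
  · simp [jordanIndexEquiv_none, jordanDegree, hp]

theorem hilbertComm_eq {K : Type*} [Field K] [CharZero K] (n : ℕ)
    (α : Matrix (Fin (n + 1)) (Fin (n + 1)) K) (h1 : ∀ i, α i (Fin.last n) = 0)
    (h2 : ∀ j, α (Fin.last n) j = 0) : hilbertComm α = ((1 - PowerSeries.X) ^ 2)⁻¹ *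
      (hilbertComm (α.submatrix Fin.castSucc Fin.castSucc) +
        PowerSeries.X * hilbertOmega (α.submatrix Fin.castSucc Fin.castSucc)) := by
  have he : (fun y : Fin n => finSuccEquivLast.symm (some y)) = Fin.castSucc := by
    funext y; simp
  have h := one_sub_sq_mul_hilbertSeries (K := K) (finSuccEquivLast (n := n)).symm
    (α := α) (w := totalDegree _) (t := ()) (by simpa using h1) (by simpa using h2)
    (fun _ => by simp [totalDegree]) rfl
  rw [he] at h
  exact eq_inv_sq_mul () h

end FreeMetabelian

end

theorem mainTheorem7 (K : Type*) [Field K] [CharZero K] :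
    -- bigraded: `δ = δ(p₁, …, p_s, 0)` in a Jordan basis, the last cell being `1 × 1`
    (∀ (s : ℕ) (p : Fin (s + 1) → ℕ), p (Fin.last s) = 0 →
      FreeMetabelian.hilbertCommGL K p =
        ((1 - MvPowerSeries.X 2) ^ 2)⁻¹ *
          (FreeMetabelian.hilbertCommGL K (fun i : Fin s => p i.castSucc) +
            MvPowerSeries.X 2 *
              FreeMetabelian.hilbertOmegaGL K (fun i : Fin s => p i.castSucc))) ∧
    -- graded: `δ` acts on `K X_n` nilpotently (the basis `X_n` need not be a Jordan one),
    -- and `δ` kills the last variable of `X_{n+1}`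
    (∀ (n : ℕ) (α : Matrix (Fin (n + 1)) (Fin (n + 1)) K), IsNilpotent α →
      (∀ i, α i (Fin.last n) = 0) → (∀ j, α (Fin.last n) j = 0) →
      FreeMetabelian.hilbertComm α =
        ((1 - PowerSeries.X) ^ 2)⁻¹ *
          (FreeMetabelian.hilbertComm (α.submatrix Fin.castSucc Fin.castSucc) +
            PowerSeries.X *
              FreeMetabelian.hilbertOmega (α.submatrix Fin.castSucc Fin.castSucc))) :=
  ⟨fun s p hp => FreeMetabelian.hilbertCommGL_eq K s p hp,
    fun n α _ h1 h2 => FreeMetabelian.hilbertComm_eq n α h1 h2⟩
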